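/- Let $\Lambda$ be a locally compact Polish space with a positive Radon measure $\mu$ on its Borel $\sigma$-algebra. A point process is a random integer-valued Radon measure $\chi$ on $\Lambda$; it is simple if almost surely $\chi(\{x\})\le 1$ for all $x$. A simple point process $\chi$ is determinantal with kernel $K:\Lambda\times\Lambda\to\mathbb C$ if for every $k\ge 1$ the function $\varrho_k(x_1,\dots,x_k)=\det\big(K(x_i,x_j)\big)_{i,j=1}^k$ is ($\mu^{k}$-a.e.) nonnegative, locally integrable, and satisfies $\mathbb E\big(\prod_{i=1}^k\chi(D_i)\big)=\int_{\prod_i D_i}\varrho_k\,d\mu^{k}$ for all mutually disjoint measurable $D_1,\dots,D_k\subset\Lambda$. The kernel $K$ is good if the integral operator $\mathcal K f(x)=\int K(x,y)f(y)\,d\mu(y)$ on $L^2(\mu)$ is self-adjoint and locally trace class with spectrum in $[0,1]$, the values of $K$ on the diagonal being normalised, as usual, so that $\int_C K(x,x)\,d\mu(x)$ is the trace of the operator with kernel $1_C(x)K(x,y)1_C(y)$ for every compact $C\subset\Lambda$. Let $(\chi_n)_n$ be a sequence of determinantal point processes on $\Lambda$ with good kernels $K_n$, and let $D_n\subset\Lambda$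 be measurable sets such that the integral operator with the restricted kernel $(K_n)_{D_n}(x,y)=1_{D_n}(x)K_n(x,y)1_{D_n}(y)$ is trace class. Let $(\eta_k^n)_k$ be the eigenvalues of this operator, counted with multiplicity, and let $(a_n)_n$ be a sequence of real numbers such that $$1\ll a_n\ll\Big(\sum_{k}\eta_k^n(1-\eta_k^n)\Big)^{1/2},$$ where $b_n\ll c_n$ means $b_n/c_n\to 0$ as $n\to\infty$. Then $\chi_n(D_n)$ is almost surely finite with finite variance $\mathbb V(\chi_n(D_n))$ for every $n$, this variance is positive for all large $n$, and the sequence $$Z_n=\frac{1}{a_n}\,\frac{\chi_n(D_n)-\mathbb E(\chi_n(D_n))}{\sqrt{\mathbb V(\chi_n(D_n))}}$$ satisfies a moderate deviation principle with speed $a_n^2$ and good rate function $I(x)=x^2/2$: one has $a_n^2\to\infty$, the level sets of $I$ are compact, for every closed $F\subset\mathbb R$ $$\limsup_{n\to\infty}\frac1{a_n^2}\log P(Z_n\in F)\le-\inf_{x\in F}\frac{x^2}{2},$$ and for every open $O\subset\mathbb R$ $$\liminf_{n\to\infty}\frac1{a_n^2}\log P(Z_n\in O)\ge-\inf_{x\in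 O}\frac{x^2}{2}.$$ -/

import Mathlib

open MeasureTheory ProbabilityTheory Filter Topology
open scoped ENNReal InnerProductSpace

noncomputable section

/-! ### Large deviation principles -/

/-- The laws `ν n` on `X` satisfy the large deviation principle with speed `s n → ∞` and good
rate function `I : X → [0, ∞)`. The bounds are read in the extended reals, with `log 0 = -∞` and
`inf ∅ = +∞`. -/
structure SatisfiesLDP {X : Type*} [TopologicalSpace X] [MeasurableSpace X]
    (ν : ℕ → Measure X) (s : ℕ → ℝ) (I : X → ℝ) : Prop where
  speed : Tendsto s atTop atTop
  nonneg : ∀ x, 0 ≤ I x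
  isCompact_levelSet : ∀ M : ℝ, 0 ≤ M → IsCompact {x | I x ≤ M}
  upper : ∀ F : Set X, IsClosed F →
    limsup (fun n => (((s n)⁻¹ : ℝ) : EReal) * ENNReal.log (ν n F)) atTop
      ≤ -(⨅ x ∈ F, (I x : EReal))
  lower : ∀ O : Set X, IsOpen O →
    -(⨅ x ∈ O, (I x : EReal))
      ≤ liminf (fun n => (((s n)⁻¹ : ℝ) : EReal) * ENNReal.log (ν n O)) atTop

/-! ### Trace class operators and eigenvalues -/

/-- `T` is trace class: `∑ᵢ ⟨bᵢ, |T| bᵢ⟩ < ∞` in some (equivalently, in every) orthonormal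
basis `b`, where `|T| = (T* T)^{1/2}`. -/
def IsTraceClass {H : Type*} [NormedAddCommGroup H] [InnerProductSpace ℂ H] [CompleteSpace H]
    (T : H →L[ℂ] H) : Prop :=
  ∃ (s : Set H) (b : HilbertBasis s ℂ H), Summable fun i => (⟪b i, CFC.abs T (b i)⟫_ℂ).re

/-- The trace of `T`, computed in any orthonormal basis, is `t`. -/
def HasTrace {H : Type*} [NormedAddCommGroup H] [InnerProductSpace ℂ H]
    (T : H →L[ℂ] H) (t : ℂ) : Prop :=
  ∀ (s : Set H) (b : HilbertBasis s ℂ H), HasSum (fun i => ⟪b i, T (b i)⟫_ℂ) t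

/-- `∑ₖ ηₖ (1 - ηₖ)` over the eigenvalues `ηₖ` of `T`, repeated according to multiplicity, for an
operator whose eigenvalues are real: every real `r` contributes `r (1 - r)` as many times as the
dimension of its eigenspace (numbers that are not eigenvalues, and `r = 0`, contribute `0`). -/
def eigenvalueSum {H : Type*} [NormedAddCommGroup H] [InnerProductSpace ℂ H]
    (T : H →L[ℂ] H) : ℝ :=
  ∑' r : ℝ, (Module.finrank ℂ (Module.End.eigenspace (T : H →ₗ[ℂ] H) (r : ℂ)) : ℝ) * (r * (1 - r))

/-! ### Integral operators and good kernels -/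

section Kernel

variable {Λ : Type*} [MeasurableSpace Λ]

/-- `T` is the integral operator on `L²(μ)` with kernel `K`: `(T f)(x) = ∫ K(x, y) f(y) dμ(y)`. -/
def IsIntegralOperator (μ : Measure Λ) (K : Λ → Λ → ℂ) (T : Lp ℂ 2 μ →L[ℂ] Lp ℂ 2 μ) : Prop :=
  ∀ f : Lp ℂ 2 μ, ∀ᵐ x ∂μ,
    Integrable (fun y => K x y * f y) μ ∧ (T f : Λ → ℂ) x = ∫ y, K x y * f y ∂μ

/-- The restricted kernel `K_D(x, y) = 1_D(x) K(x, y) 1_D(y)`. -/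
def restrictKernel (K : Λ → Λ → ℂ) (D : Set Λ) : Λ → Λ → ℂ :=
  fun x y => D.indicator 1 x * K x y * D.indicator 1 y

/-- `T` is an admissible integral operator with admissible kernel `K`: it is self-adjoint,
nonnegative and locally trace class. A kernel is determined by its operator only almost everywhere
for `μ × μ`; as usual its values on the diagonal are normalised so that the trace of the
restriction to a compact set `C` is `∫_C K(x, x) dμ(x)`. -/
structure IsAdmissible [TopologicalSpace Λ] (μ : Measure Λ) (K : Λ → Λ → ℂ)
    (T : Lp ℂ 2 μ →L[ℂ] Lp ℂ 2 μ) : Prop where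
  measurable : Measurable (Function.uncurry K)
  isIntegralOperator : IsIntegralOperator μ K T
  isSelfAdjoint : IsSelfAdjoint T
  nonneg : ∀ f : Lp ℂ 2 μ, 0 ≤ (⟪f, T f⟫_ℂ).re
  locallyTraceClass : ∀ C : Set Λ, IsCompact C → ∃ TC : Lp ℂ 2 μ →L[ℂ] Lp ℂ 2 μ,
    IsIntegralOperator μ (restrictKernel K C) TC ∧ IsTraceClass TC ∧
      IntegrableOn (fun x => K x x) C μ ∧ HasTrace TC (∫ x in C, K x x ∂μ)

/-- `K` is a good kernel: it is admissible and the spectrum of its operator lies in `[0, 1]`.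
For an operator with an expansion `T f = ∑ₖ ηₖ ⟨φₖ, f⟩ φₖ`, where the `φₖ` are orthonormal and
`ηₖ > 0`, the latter says exactly that all `ηₖ` lie in `(0, 1]`; operators that are not compact and
have no such expansion are allowed as well. -/
def IsGoodKernel [TopologicalSpace Λ] (μ : Measure Λ) (K : Λ → Λ → ℂ) : Prop :=
  ∃ T : Lp ℂ 2 μ →L[ℂ] Lp ℂ 2 μ, IsAdmissible μ K T ∧ spectrum ℝ T ⊆ Set.Icc 0 1

end Kernel

/-! ### Determinantal point processes -/

section PointProcess

variable {Λ Ω : Type*} [TopologicalSpace Λ] [MeasurableSpace Λ] [MeasurableSpace Ω]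

/-- `χ` is a simple point process: a random integer-valued Radon measure without multiple points.
Measurability of `χ` means that `χ(B)` is a random variable for all measurable `B`. On a locally
compact Polish space a Borel measure is Radon as soon as it is locally finite. -/
structure IsSimplePointProcess (P : Measure Ω) (χ : Ω → Measure Λ) : Prop where
  measurable : Measurable χ
  locallyFinite : ∀ᵐ ω ∂P, IsLocallyFiniteMeasure (χ ω)
  integerValued : ∀ᵐ ω ∂P, ∀ B, MeasurableSet B → ∃ m : ℕ∞, χ ω B = (m : ℝ≥0∞)
  simple : ∀ᵐ ω ∂P, ∀ x, χ ω {x} ≤ 1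

/-- `ρ` is a `k`-th joint intensity of `χ` with respect to `μ`. -/
structure IsJointIntensity (P : Measure Ω) (χ : Ω → Measure Λ) (μ : Measure Λ) (k : ℕ)
    (ρ : (Fin k → Λ) → ℝ) : Prop where
  nonneg : ∀ x, 0 ≤ ρ x
  locallyIntegrable : LocallyIntegrable ρ (Measure.pi fun _ => μ)
  lintegral_eq : ∀ D : Fin k → Set Λ, (∀ i, MeasurableSet (D i)) →
    (Pairwise fun i j => Disjoint (D i) (D j)) →
    ∫⁻ ω, ∏ i, χ ω (D i) ∂P
      = ∫⁻ x in Set.univ.pi D, ENNReal.ofReal (ρ x) ∂(Measure.pi fun _ => μ)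

/-- `χ` is a determinantal point process with kernel `K` (with respect to `μ`): it is simple and
its joint intensities of all orders `k ≥ 1` exist and are `det (K(xᵢ, xⱼ))`, up to null sets. -/
structure IsDeterminantal (P : Measure Ω) (χ : Ω → Measure Λ) (μ : Measure Λ)
    (K : Λ → Λ → ℂ) : Prop where
  isSimplePointProcess : IsSimplePointProcess P χ
  jointIntensity : ∀ k : ℕ, 1 ≤ k → ∃ ρ : (Fin k → Λ) → ℝ, IsJointIntensity P χ μ k ρ ∧
    ∀ᵐ x ∂(Measure.pi fun _ : Fin k => μ),
      (ρ x : ℂ) = (Matrix.of fun i j => K (x i) (x j)).det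

/-- The number of points of `χ` in `D`, as a real random variable. -/
def countIn (χ : Ω → Measure Λ) (D : Set Λ) : Ω → ℝ := fun ω => (χ ω D).toReal

end PointProcess

end

noncomputable section

/-! ### A large deviation principle from quadratic limits of cumulant generating functions -/

section LargeDeviations

variable {Ω : ℕ → Type*} [∀ n, MeasurableSpace (Ω n)] {P : ∀ n, Measure (Ω n)}
  [∀ n, IsProbabilityMeasure (P n)] {Z : ∀ n, Ω n → ℝ} {s : ℕ → ℝ}

/-! Let `η j` be the nonzero eigenvalues of the restricted operator. The count in `D` has the
Laplace transform of a sum of independent Bernoulli variables with parameters `η j`, so its cumulant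
generating function is `∑ log (1 - η j + η j e^s)`. A second order expansion of each term, with
error at most `2 η j (1 - η j) |s|³`, gives `m s + V s² / 2` up to `2 V |s|³`, where `m` is the mean
and `V = ∑ η j (1 - η j)` the variance. At `s = θ a / √V` the centred function divided by `a²` is
`θ² / 2` up to a multiple of `a / √V`, which tends to zero. A Gärtner–Ellis argument for this
quadratic limit (`satisfiesLDP_of_tendsto_cgf`) then gives the moderate deviation principle.

No Bernoulli variables are constructed; the Laplace transform is recovered from factorial moments.
Cutting `D` into ever finer cells, which eventually hold at most one point each, identifies the
`k`-th factorial moment with the integral of `det K(xᵢ, xⱼ)` over `D^k`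
(`IsSimplePointProcess.lintegral_descFactorial`, `setLIntegral_injective_intensity`). Inserting
`K(x, y) = ∑ ηⱼ φⱼ(x) conj (φⱼ(y))` and using orthonormality, this integral is `k!` times the `k`-th
elementary symmetric function of the eigenvalues (`HasKernelExpansion.integrable_det_and_tendsto`).
The generating series of these functions is `∏ (1 + w ηⱼ)`, and `w = e^s - 1` gives the Laplace
transform (`hasBernoulliMGF_of_choose`).

The expansion comes from the spectral theorem for positive compact operators. The eigenvalues lie in
`(0, 1]` because the restricted operator is a compression of one between `0` and `1`. An operator
determines its kernel only up to a `μ × μ`-null set, and the diagonal may be such a set. The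
expansion on the diagonal is therefore a separate matter, settled by the trace normalisation on
compact sets (`IsAdmissible.ae_restrict_diag`). -/

lemma eventually_mgf_mem_Icc (hs : Tendsto s atTop atTop)
    (hint : ∀ n t, Integrable (fun ω => Real.exp (t * Z n ω)) (P n))
    (hcgf : ∀ θ : ℝ, Tendsto (fun n => (s n)⁻¹ * cgf (Z n) (P n) (θ * s n)) atTop
      (𝓝 (θ ^ 2 / 2))) (θ : ℝ) {κ : ℝ} (hκ : 0 < κ) :
    ∀ᶠ n in atTop, Real.exp (s n * (θ ^ 2 / 2 - κ)) ≤ mgf (Z n) (P n) (θ * s n) ∧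
      mgf (Z n) (P n) (θ * s n) ≤ Real.exp (s n * (θ ^ 2 / 2 + κ)) := by
  have h1 := (hcgf θ).eventually (Ioo_mem_nhds (by linarith : θ ^ 2 / 2 - κ < θ ^ 2 / 2)
    (by linarith : θ ^ 2 / 2 < θ ^ 2 / 2 + κ))
  filter_upwards [h1, hs.eventually_gt_atTop 0] with n hn hsn
  rw [← exp_cgf (hint n _), Real.exp_le_exp, Real.exp_le_exp]
  have h2 : cgf (Z n) (P n) (θ * s n) = s n * ((s n)⁻¹ * cgf (Z n) (P n) (θ * s n)) := by
    field_simp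
  rw [h2]
  exact ⟨by gcongr; exact hn.1.le, by gcongr; exact hn.2.le⟩

lemma eventually_const_le_exp_mul (hs : Tendsto s atTop atTop) (C : ℝ) {κ : ℝ} (hκ : 0 < κ) :
    ∀ᶠ n in atTop, C ≤ Real.exp (s n * κ) :=
  (Real.tendsto_exp_atTop.comp (hs.atTop_mul_const hκ)).eventually_ge_atTop C

/-- Chernoff's bound with the optimal tilts `θ = r` and `θ = -r` for the two tails. As the rate
function is even and increasing in `|x|`, this two-sided tail is all that the upper bound needs. -/
lemma eventually_measureReal_abs_ge_le (hs : Tendsto s atTop atTop)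
    (hint : ∀ n t, Integrable (fun ω => Real.exp (t * Z n ω)) (P n))
    (hcgf : ∀ θ : ℝ, Tendsto (fun n => (s n)⁻¹ * cgf (Z n) (P n) (θ * s n)) atTop
      (𝓝 (θ ^ 2 / 2))) {r c : ℝ} (hr : 0 ≤ r) (hc : c < r ^ 2 / 2) :
    ∀ᶠ n in atTop, (P n).real {ω | r ≤ |Z n ω|} ≤ Real.exp (-(s n * c)) := by
  -- Half of the gap absorbs the error in the generating function, the other half the factor `2`
  -- from the two tails.
  set κ := (r ^ 2 / 2 - c) / 2 with hκdef
  have hκ : 0 < κ := by rw [hκdef]; linarith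
  filter_upwards [eventually_mgf_mem_Icc hs hint hcgf r hκ,
    eventually_mgf_mem_Icc hs hint hcgf (-r) hκ, eventually_const_le_exp_mul hs 2 hκ,
    hs.eventually_gt_atTop 0] with n h1 h2 h3 h4
  have e1 := measure_ge_le_exp_mul_mgf (μ := P n) (X := Z n) r (by positivity : 0 ≤ r * s n)
    (hint n _)
  have e2 := measure_le_le_exp_mul_mgf (μ := P n) (X := Z n) (-r)
    (by nlinarith : -r * s n ≤ 0) (hint n _)
  have hsub : {ω | r ≤ |Z n ω|} ⊆ {ω | r ≤ Z n ω} ∪ {ω | Z n ω ≤ -r} := by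
    intro ω hω
    rcases le_abs.1 (show r ≤ |Z n ω| from hω) with h | h
    · exact Or.inl h
    · exact Or.inr (show Z n ω ≤ -r by linarith)
  have e3 : ∀ x, x ≤ Real.exp (s n * (r ^ 2 / 2 + κ)) →
      Real.exp (-(r * s n) * r) * x ≤ Real.exp (-(s n * (c + κ))) := by
    intro x hx
    calc _ ≤ Real.exp (-(r * s n) * r) * Real.exp (s n * (r ^ 2 / 2 + κ)) := by gcongr
      _ = Real.exp (-(s n * (c + κ))) := by
        rw [← Real.exp_add]; congr 1; rw [hκdef]; ring
  calc (P n).real {ω | r ≤ |Z n ω|} ≤ (P n).real {ω | r ≤ Z n ω} + (P n).real {ω | Z n ω ≤ -r} :=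
        (measureReal_mono hsub).trans (measureReal_union_le _ _)
    _ ≤ Real.exp (-(s n * (c + κ))) + Real.exp (-(s n * (c + κ))) := by
        refine add_le_add (e1.trans (e3 _ h1.2)) (e2.trans ?_)
        have := e3 _ (h2.2.trans_eq (by rw [neg_sq]))
        rwa [show -(-r * s n) * -r = -(r * s n) * r by ring]
    _ = 2 * Real.exp (-(s n * (c + κ))) := by ring
    _ ≤ Real.exp (s n * κ) * Real.exp (-(s n * (c + κ))) := by gcongr
    _ = Real.exp (-(s n * c)) := by rw [← Real.exp_add]; congr 1; ring

/-- Under the exponential tilt with parameter `x * s n`, the variable concentrates at `x`. The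
tilted measure is never formed: the moment generating function at `x * s n` is split into the part
near `x` and two tails, and the tails are exponentially smaller than the whole. -/
lemma eventually_le_measureReal_abs_sub_lt (hs : Tendsto s atTop atTop)
    (hZ : ∀ n, Measurable (Z n))
    (hint : ∀ n t, Integrable (fun ω => Real.exp (t * Z n ω)) (P n))
    (hcgf : ∀ θ : ℝ, Tendsto (fun n => (s n)⁻¹ * cgf (Z n) (P n) (θ * s n)) atTop
      (𝓝 (θ ^ 2 / 2))) (x : ℝ) {δ : ℝ} (hδ : 0 < δ) :
    ∀ᶠ n in atTop, Real.exp (-(s n * (x ^ 2 / 2 + |x| * δ + δ ^ 2 / 4))) ≤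
      (P n).real {ω | |Z n ω - x| < δ} := by
  -- Shifting the tilt by `±δ` bounds each tail with exponent `x ^ 2 / 2 - δ ^ 2 / 2 + κ`, which is
  -- `x ^ 2 / 2 - 3 * κ`. This leaves room `2 * κ` below the lower bound `x ^ 2 / 2 - κ` for the
  -- constants.
  set κ := δ ^ 2 / 8 with hκdef
  have hκ : 0 < κ := by positivity
  filter_upwards [eventually_mgf_mem_Icc hs hint hcgf x hκ,
    eventually_mgf_mem_Icc hs hint hcgf (x + δ) hκ,
    eventually_mgf_mem_Icc hs hint hcgf (x - δ) hκ, eventually_const_le_exp_mul hs 4 hκ,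
    hs.eventually_gt_atTop 0] with n h1 h2 h3 h4 h5
  have hS : MeasurableSet {ω | |Z n ω - x| < δ} :=
    measurableSet_lt ((hZ n).sub_const x).abs measurable_const
  set p := (P n).real {ω | |Z n ω - x| < δ}
  -- Where `Z ≥ x + δ` the factor `exp (s δ (Z - x - δ))` is at least `1`, and where `Z ≤ x - δ` so
  -- is `exp (s δ (x - δ - Z))`.
  have hpt : ∀ ω, Real.exp (x * s n * Z n ω) ≤
      {ω | |Z n ω - x| < δ}.indicator (fun _ => Real.exp (s n * (x ^ 2 + |x| * δ))) ω
      + (Real.exp (-(s n * δ * (x + δ))) * Real.exp ((x + δ) * s n * Z n ω)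
      + Real.exp (s n * δ * (x - δ)) * Real.exp ((x - δ) * s n * Z n ω)) := by
    intro ω
    rw [← Real.exp_add, ← Real.exp_add]
    have p1 := Real.exp_pos (-(s n * δ * (x + δ)) + (x + δ) * s n * Z n ω)
    have p2 := Real.exp_pos (s n * δ * (x - δ) + (x - δ) * s n * Z n ω)
    by_cases h : |Z n ω - x| < δ
    · rw [Set.indicator_of_mem (by exact h)]
      have : Real.exp (x * s n * Z n ω) ≤ Real.exp (s n * (x ^ 2 + |x| * δ)) := by
        rw [Real.exp_le_exp]
        have : x * (Z n ω - x) ≤ |x| * δ :=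
          (le_abs_self _).trans (by rw [abs_mul]; gcongr)
        nlinarith
      linarith
    · rw [Set.indicator_of_notMem (by exact h), zero_add]
      rcases le_abs.1 (not_lt.1 h) with h | h
      · have : Real.exp (x * s n * Z n ω) ≤
            Real.exp (-(s n * δ * (x + δ)) + (x + δ) * s n * Z n ω) := by
          rw [Real.exp_le_exp]
          nlinarith [mul_nonneg (mul_nonneg h5.le hδ.le) (by linarith : 0 ≤ Z n ω - x - δ)]
        linarith
      · have : Real.exp (x * s n * Z n ω) ≤
            Real.exp (s n * δ * (x - δ) + (x - δ) * s n * Z n ω) := by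
          rw [Real.exp_le_exp]
          nlinarith [mul_nonneg (mul_nonneg h5.le hδ.le) (by linarith : 0 ≤ x - δ - Z n ω)]
        linarith
  have i1 : Integrable ({ω | |Z n ω - x| < δ}.indicator
      (fun _ => Real.exp (s n * (x ^ 2 + |x| * δ)))) (P n) :=
    (integrable_const _).indicator hS
  have i2 := (hint n ((x + δ) * s n)).const_mul (Real.exp (-(s n * δ * (x + δ))))
  have i3 := (hint n ((x - δ) * s n)).const_mul (Real.exp (s n * δ * (x - δ)))
  have hI : mgf (Z n) (P n) (x * s n) ≤ p * Real.exp (s n * (x ^ 2 + |x| * δ))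
      + (Real.exp (-(s n * δ * (x + δ))) * mgf (Z n) (P n) ((x + δ) * s n)
      + Real.exp (s n * δ * (x - δ)) * mgf (Z n) (P n) ((x - δ) * s n)) := by
    have : ∫ ω, Real.exp (x * s n * Z n ω) ∂P n ≤ _ :=
      integral_mono (hint n (x * s n)) (i1.add (i2.add i3)) hpt
    rw [integral_add' i1 (i2.add i3), integral_add' i2 i3, integral_indicator_const _ hS,
      integral_const_mul, integral_const_mul, smul_eq_mul] at this
    exact this
  have b2 : Real.exp (-(s n * δ * (x + δ))) * mgf (Z n) (P n) ((x + δ) * s n) ≤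
      Real.exp (s n * (x ^ 2 / 2 - 3 * κ)) := by
    refine (mul_le_mul_of_nonneg_left h2.2 (Real.exp_pos _).le).trans_eq ?_
    rw [← Real.exp_add]; congr 1; rw [hκdef]; ring
  have b3 : Real.exp (s n * δ * (x - δ)) * mgf (Z n) (P n) ((x - δ) * s n) ≤
      Real.exp (s n * (x ^ 2 / 2 - 3 * κ)) := by
    refine (mul_le_mul_of_nonneg_left h3.2 (Real.exp_pos _).le).trans_eq ?_
    rw [← Real.exp_add]; congr 1; rw [hκdef]; ring
  have b4 : 4 * Real.exp (s n * (x ^ 2 / 2 - 3 * κ)) ≤ Real.exp (s n * (x ^ 2 / 2 - 2 * κ)) := by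
    calc _ ≤ Real.exp (s n * κ) * Real.exp (s n * (x ^ 2 / 2 - 3 * κ)) := by gcongr
      _ = _ := by rw [← Real.exp_add]; congr 1; ring
  have b5 : 2 * Real.exp (s n * (x ^ 2 / 2 - 2 * κ)) ≤ Real.exp (s n * (x ^ 2 / 2 - κ)) := by
    calc _ ≤ Real.exp (s n * κ) * Real.exp (s n * (x ^ 2 / 2 - 2 * κ)) := by gcongr; linarith
      _ = _ := by rw [← Real.exp_add]; congr 1; ring
  have b6 : Real.exp (s n * (x ^ 2 / 2 - 2 * κ)) ≤ p * Real.exp (s n * (x ^ 2 + |x| * δ)) := by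
    have := Real.exp_pos (s n * (x ^ 2 / 2 - 2 * κ))
    linarith [h1.1]
  rw [← div_le_iff₀ (Real.exp_pos _), ← Real.exp_sub] at b6
  refine le_of_eq_of_le ?_ b6
  congr 1; rw [hκdef]; ring

lemma log_ofReal_exp (y : ℝ) : ENNReal.log (ENNReal.ofReal (Real.exp y)) = (y : EReal) := by
  rw [← EReal.exp_coe, EReal.log_exp]

lemma inv_mul_log_le {s y : ℝ} (hs : 0 < s) {m : ℝ≥0∞}
    (h : m ≤ ENNReal.ofReal (Real.exp (s * y))) :
    ((s⁻¹ : ℝ) : EReal) * ENNReal.log m ≤ (y : EReal) := by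
  have h1 : ENNReal.log m ≤ ((s * y : ℝ) : EReal) := by
    rw [← log_ofReal_exp]; exact ENNReal.log_monotone h
  refine (mul_le_mul_of_nonneg_left h1 (by exact_mod_cast (inv_pos.2 hs).le)).trans_eq ?_
  rw [← EReal.coe_mul]; congr 1; field_simp

lemma le_inv_mul_log {s y : ℝ} (hs : 0 < s) {m : ℝ≥0∞}
    (h : ENNReal.ofReal (Real.exp (s * y)) ≤ m) :
    (y : EReal) ≤ ((s⁻¹ : ℝ) : EReal) * ENNReal.log m := by
  have h1 : ((s * y : ℝ) : EReal) ≤ ENNReal.log m := by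
    rw [← log_ofReal_exp]; exact ENNReal.log_monotone h
  refine le_of_eq_of_le ?_ (mul_le_mul_of_nonneg_left h1 (by exact_mod_cast (inv_pos.2 hs).le))
  rw [← EReal.coe_mul]; congr 1; field_simp

/-- Normalised cumulant generating functions converging to `θ² / 2` imply the large deviation
principle with rate function `x² / 2`. -/
theorem satisfiesLDP_of_tendsto_cgf (hs : Tendsto s atTop atTop) (hZ : ∀ n, Measurable (Z n))
    (hint : ∀ n t, Integrable (fun ω => Real.exp (t * Z n ω)) (P n))
    (hcgf : ∀ θ : ℝ, Tendsto (fun n => (s n)⁻¹ * cgf (Z n) (P n) (θ * s n)) atTop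
      (𝓝 (θ ^ 2 / 2))) :
    SatisfiesLDP (fun n => (P n).map (Z n)) s (fun x : ℝ => x ^ 2 / 2) where
  speed := hs
  nonneg x := by positivity
  isCompact_levelSet M hM := by
    refine Metric.isCompact_of_isClosed_isBounded (isClosed_le (by fun_prop) continuous_const) ?_
    refine (Metric.isBounded_Icc (-(2 * M + 1)) (2 * M + 1)).subset fun x hx => ?_
    have hx : x ^ 2 / 2 ≤ M := hx
    constructor <;> nlinarith [sq_nonneg (x - 1), sq_nonneg (x + 1)]
  upper F hF := by
    rw [EReal.le_neg]
    refine EReal.ge_of_forall_gt_iff_ge.1 fun c hc => ?_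
    rw [EReal.le_neg]
    obtain ⟨c₁, hc₁, hc₂⟩ := EReal.lt_iff_exists_real_btwn.1 hc
    -- If `c₁ < 0` the square root takes its default value `0`, and the bound remains true.
    have hcc : c < √(2 * c₁) ^ 2 / 2 := by
      have h1 : c < c₁ := by exact_mod_cast hc₁
      have h2 : 2 * c₁ ≤ √(2 * c₁) ^ 2 := by
        rcases le_total 0 (2 * c₁) with h | h
        · rw [Real.sq_sqrt h]
        · exact h.trans (sq_nonneg _)
      linarith
    have hF' : F ⊆ {x | √(2 * c₁) ≤ |x|} := by
      intro x hx
      have h1 : (c₁ : EReal) < ((x ^ 2 / 2 : ℝ) : EReal) := hc₂.trans_le (iInf₂_le x hx)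
      have h2 : c₁ < x ^ 2 / 2 := by exact_mod_cast h1
      rw [Set.mem_ofPred_eq, ← Real.sqrt_sq_eq_abs]
      exact Real.sqrt_le_sqrt (by linarith)
    refine limsup_le_of_le (h := ?_)
    filter_upwards [eventually_measureReal_abs_ge_le hs hint hcgf (Real.sqrt_nonneg _) hcc,
      hs.eventually_gt_atTop 0] with n hn hsn
    rw [← EReal.coe_neg]
    refine inv_mul_log_le hsn ?_
    rw [Measure.map_apply (hZ n) hF.measurableSet, mul_neg]
    refine (measure_mono (t := {ω | √(2 * c₁) ≤ |Z n ω|}) fun ω hω => hF' hω).trans ?_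
    rw [← ofReal_measureReal]
    exact ENNReal.ofReal_le_ofReal hn
  lower O hO := by
    rw [EReal.neg_le]
    refine le_iInf₂ fun x hx => ?_
    refine EReal.le_of_forall_lt_iff_le.1 fun y hy => ?_
    rw [EReal.neg_le]
    have hy : x ^ 2 / 2 < y := by exact_mod_cast hy
    obtain ⟨ε, hε, hεO⟩ := Metric.isOpen_iff.1 hO x hx
    have hlim : Tendsto (fun δ : ℝ => x ^ 2 / 2 + |x| * δ + δ ^ 2 / 4) (𝓝[>] 0)
        (𝓝 (x ^ 2 / 2 + |x| * 0 + 0 ^ 2 / 4)) :=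
      (Continuous.tendsto (by fun_prop) _).mono_left nhdsWithin_le_nhds
    -- The radius is chosen so small that the ball lies in `O` and the exponent of the local lower
    -- bound is still below `y`.
    obtain ⟨δ, hδ, hδ0, hδε⟩ := ((hlim.eventually_lt_const (by simpa using hy)).and
      (Ioo_mem_nhdsGT hε)).exists
    refine le_liminf_of_le (h := ?_)
    filter_upwards [eventually_le_measureReal_abs_sub_lt hs hZ hint hcgf x hδ0,
      hs.eventually_gt_atTop 0] with n hn hsn
    rw [← EReal.coe_neg]
    refine le_inv_mul_log hsn ?_
    rw [Measure.map_apply (hZ n) hO.measurableSet]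
    refine le_trans ?_ (measure_mono (s := {ω | |Z n ω - x| < δ}) fun ω hω => hεO ?_)
    · rw [← ofReal_measureReal]
      refine ENNReal.ofReal_le_ofReal (le_trans ?_ hn)
      rw [Real.exp_le_exp, mul_neg, neg_le_neg_iff]
      gcongr
    · rw [Metric.mem_ball, Real.dist_eq]
      exact lt_trans hω hδε

end LargeDeviations

/-! ### Cumulants of sums of Bernoulli variables -/

section Bernoulli

lemma one_sub_add_mul_exp_pos {p : ℝ} (hp : p ∈ Set.Icc (0 : ℝ) 1) (s : ℝ) :
    0 < 1 - p + p * Real.exp s := by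
  have h := Real.exp_pos s
  rcases hp.1.eq_or_lt with h0 | h0
  · simp [← h0]
  · nlinarith [mul_pos h0 h, hp.2]

/-- The denominator `1 - p + p e^s` is a convex combination of `1` and `e^s`, so the quotient lies
between `e^{-|s|}` and `e^{|s|}`. Multiplied by `p (1 - p)`, the quotient is the second derivative
of the Bernoulli cumulant generating function. -/
lemma abs_exp_div_sq_sub_one_le {p s : ℝ} (hp : p ∈ Set.Icc (0 : ℝ) 1) (hs : |s| ≤ 1) :
    |Real.exp s / (1 - p + p * Real.exp s) ^ 2 - 1| ≤ 2 * |s| := by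
  obtain ⟨hp0, hp1⟩ := hp
  have hd := one_sub_add_mul_exp_pos ⟨hp0, hp1⟩ s
  set d := 1 - p + p * Real.exp s with hdd
  have he := Real.exp_pos s
  have key : Real.exp (-|s|) ≤ Real.exp s / d ^ 2 ∧ Real.exp s / d ^ 2 ≤ Real.exp |s| := by
    rw [le_div_iff₀ (by positivity), div_le_iff₀ (by positivity)]
    rcases le_total 0 s with h | h
    · have h1 : 1 ≤ Real.exp s := Real.one_le_exp h
      have d1 : 1 ≤ d := by rw [hdd]; nlinarith
      have d2 : d ≤ Real.exp s := by rw [hdd]; nlinarith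
      rw [abs_of_nonneg h, Real.exp_neg]
      constructor
      · rw [inv_mul_le_iff₀ he]; nlinarith
      · exact le_mul_of_one_le_right he.le (one_le_pow₀ d1)
    · have h1 : Real.exp s ≤ 1 := Real.exp_le_one_iff.2 h
      have d1 : d ≤ 1 := by rw [hdd]; nlinarith
      have d2 : Real.exp s ≤ d := by rw [hdd]; nlinarith
      rw [abs_of_nonpos h, neg_neg, Real.exp_neg]
      constructor
      · exact mul_le_of_le_one_right he.le (pow_le_one₀ hd.le d1)
      · rw [← div_eq_inv_mul, le_div_iff₀ he]; nlinarith
  have b1 : Real.exp |s| - 1 ≤ 2 * |s| := by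
    have := Real.abs_exp_sub_one_le (x := |s|) (by rwa [abs_abs])
    rw [abs_abs] at this
    exact (le_abs_self _).trans this
  have b2 : 1 - Real.exp (-|s|) ≤ |s| := by linarith [Real.add_one_le_exp (-|s|)]
  rw [abs_le]
  constructor <;> linarith [key.1, key.2, abs_nonneg s]

/-- Second order expansion of the cumulant generating function of a Bernoulli variable. -/
lemma abs_log_bernoulli_sub_le {p s : ℝ} (hp : p ∈ Set.Icc (0 : ℝ) 1) (hs : |s| ≤ 1) :
    |Real.log (1 - p + p * Real.exp s) - p * s - p * (1 - p) * s ^ 2 / 2| ≤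
      2 * (p * (1 - p)) * |s| ^ 3 := by
  have hp' : 0 ≤ p * (1 - p) := mul_nonneg hp.1 (by linarith [hp.2])
  set u : ℝ → ℝ := fun t =>
    Real.log (1 - p + p * Real.exp t) - p * t - p * (1 - p) * t ^ 2 / 2 with hu
  set v : ℝ → ℝ := fun t =>
    p * Real.exp t / (1 - p + p * Real.exp t) - p - p * (1 - p) * t with hv
  have hu' : ∀ t, HasDerivAt u (v t) t := by
    intro t
    have hd := one_sub_add_mul_exp_pos hp t
    have h1 : HasDerivAt (fun t => 1 - p + p * Real.exp t) (p * Real.exp t) t :=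
      ((Real.hasDerivAt_exp t).const_mul p).const_add (1 - p)
    have h2 := ((h1.log hd.ne').sub ((hasDerivAt_id t).const_mul p)).sub
      ((((hasDerivAt_id t).pow 2).const_mul (p * (1 - p))).div_const 2)
    refine h2.congr_deriv ?_
    simp only [hv, id]; push_cast; ring
  have hv' : ∀ t, HasDerivAt v
      (p * (1 - p) * (Real.exp t / (1 - p + p * Real.exp t) ^ 2 - 1)) t := by
    intro t
    have hd := one_sub_add_mul_exp_pos hp t
    have h1 : HasDerivAt (fun t => 1 - p + p * Real.exp t) (p * Real.exp t) t :=
      ((Real.hasDerivAt_exp t).const_mul p).const_add (1 - p)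
    have h2 := ((((Real.hasDerivAt_exp t).const_mul p).div h1 hd.ne').sub_const p).sub
      ((hasDerivAt_id t).const_mul (p * (1 - p)))
    refine h2.congr_deriv ?_
    field_simp; ring
  -- The remainder and its derivative both vanish at `0`, so the mean value inequality, applied
  -- twice, integrates the bound on the second derivative. The factor `p (1 - p)` survives, which
  -- makes the error comparable to the variance after summation.
  have bnd : ∀ (f f' : ℝ → ℝ) (B : ℝ), (∀ t, HasDerivAt f (f' t) t) → f 0 = 0 →
      ∀ t, (∀ r, |r| ≤ |t| → |f' r| ≤ B) → |f t| ≤ B * |t| := by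
    intro f f' B hf hf0 t hB
    have := (convex_Icc (-|t|) |t|).norm_image_sub_le_of_norm_hasDerivWithin_le
      (f := f) (f' := f') (C := B) (fun r _ => (hf r).hasDerivWithinAt)
      (fun r hr => hB r (abs_le.2 hr)) (x := 0) (y := t)
      ⟨by simp, by simp⟩ ⟨neg_abs_le t, le_abs_self t⟩
    simpa [hf0] using this
  have hvb : ∀ t, |t| ≤ |s| → |v t| ≤ 2 * (p * (1 - p)) * |s| ^ 2 := by
    intro t ht
    have := bnd v _ (p * (1 - p) * (2 * |s|)) hv' (by simp [hv]) t fun r hr => by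
      rw [abs_mul, abs_of_nonneg hp']
      gcongr
      exact (abs_exp_div_sq_sub_one_le hp ((hr.trans ht).trans hs)).trans (by linarith)
    refine this.trans ?_
    calc _ ≤ p * (1 - p) * (2 * |s|) * |s| := by gcongr
      _ = _ := by ring
  have := bnd u v _ hu' (by simp [hu]) s hvb
  refine this.trans_eq (by ring)

variable {ι Ω : Type*} [MeasurableSpace Ω] {P : Measure Ω}

/-- `N` has the Laplace transform of a sum of independent Bernoulli variables with parameters
`η j`. -/
structure HasBernoulliMGF (N : Ω → ℝ) (P : Measure Ω) (η : ι → ℝ) : Prop where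
  mem_Icc : ∀ j, η j ∈ Set.Icc (0 : ℝ) 1
  summable : Summable η
  integrable_exp : ∀ s : ℝ, Integrable (fun ω => Real.exp (s * N ω)) P
  tendsto_prod : ∀ s : ℝ, Tendsto (fun F : Finset ι => ∏ j ∈ F, (1 - η j + η j * Real.exp s)) atTop
    (𝓝 (mgf N P s))

lemma HasBernoulliMGF.summable_variance {N : Ω → ℝ} {η : ι → ℝ} (h : HasBernoulliMGF N P η) :
    Summable fun j => η j * (1 - η j) :=
  Summable.of_nonneg_of_le (fun j => mul_nonneg (h.mem_Icc j).1 (by linarith [(h.mem_Icc j).2]))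
    (fun j => by nlinarith [(h.mem_Icc j).1]) h.summable

/-- The Bernoulli expansion is summed over finite sets and passed to the limit. The error is
controlled by the variance alone, with a universal constant, hence uniformly along a sequence of
such variables. -/
lemma HasBernoulliMGF.abs_cgf_sub_le [IsProbabilityMeasure P] {N : Ω → ℝ} {η : ι → ℝ}
    (h : HasBernoulliMGF N P η) {s : ℝ} (hs : |s| ≤ 1) :
    |cgf N P s - (∑' j, η j) * s - (∑' j, η j * (1 - η j)) * s ^ 2 / 2| ≤
      2 * (∑' j, η j * (1 - η j)) * |s| ^ 3 := by
  have hlog : Tendsto (fun F : Finset ι => ∑ j ∈ F, Real.log (1 - η j + η j * Real.exp s)) atTop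
      (𝓝 (cgf N P s)) := by
    have h1 := (h.tendsto_prod s).log (mgf_pos (h.integrable_exp s)).ne'
    refine h1.congr fun F => ?_
    exact Real.log_prod fun j _ => (one_sub_add_mul_exp_pos (h.mem_Icc j) s).ne'
  have hm : Tendsto (fun F : Finset ι => ∑ j ∈ F, η j) atTop (𝓝 (∑' j, η j)) := h.summable.hasSum
  have hV : Tendsto (fun F : Finset ι => ∑ j ∈ F, η j * (1 - η j)) atTop
    (𝓝 (∑' j, η j * (1 - η j))) := h.summable_variance.hasSum
  refine le_of_tendsto_of_tendsto
    ((hlog.sub (hm.mul_const s)).sub ((hV.mul_const (s ^ 2)).div_const 2)).abs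
    ((hV.const_mul 2).mul_const (|s| ^ 3)) (Eventually.of_forall fun F => ?_)
  simp only [Finset.sum_mul, Finset.mul_sum, Finset.sum_div, ← Finset.sum_sub_distrib]
  exact (Finset.abs_sum_le_sum_abs _ _).trans
    (Finset.sum_le_sum fun j _ => abs_log_bernoulli_sub_le (h.mem_Icc j) hs)

end Bernoulli

/-! ### Moderate deviations for Bernoulli sums -/

section ModerateDeviations

variable {Ω : ℕ → Type*} [∀ n, MeasurableSpace (Ω n)] {P : ∀ n, Measure (Ω n)}
  [∀ n, IsProbabilityMeasure (P n)] {ι : ℕ → Type*}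

/-- Moderate deviations for variables whose Laplace transforms are those of sums of independent
Bernoulli variables. -/
theorem HasBernoulliMGF.moderate_deviations {N : ∀ n, Ω n → ℝ} (hN : ∀ n, Measurable (N n))
    {η : ∀ n, ι n → ℝ} (h : ∀ n, HasBernoulliMGF (N n) (P n) (η n)) {m V : ℕ → ℝ}
    (hm : ∀ n, m n = ∑' j, η n j) (hV : ∀ n, V n = ∑' j, η n j * (1 - η n j)) {a : ℕ → ℝ}
    (ha₁ : (fun _ : ℕ => (1 : ℝ)) =o[atTop] a) (ha₂ : a =o[atTop] fun n => √(V n)) :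
    SatisfiesLDP (fun n => (P n).map fun ω => (1 / a n) * ((N n ω - m n) / √(V n)))
      (fun n => a n ^ 2) (fun x : ℝ => x ^ 2 / 2) := by
  -- The sign of `a n` is not prescribed; only its absolute value diverges.
  have habs : Tendsto (fun n => |a n|) atTop atTop := by
    have := (Asymptotics.isLittleO_const_left.1 ha₁).resolve_left one_ne_zero
    exact this
  have hs : Tendsto (fun n => a n ^ 2) atTop atTop := by
    simp_rw [← sq_abs (a _)]
    exact (tendsto_pow_atTop two_ne_zero).comp habs
  have hratio : Tendsto (fun n => a n / √(V n)) atTop (𝓝 0) := ha₂.tendsto_div_nhds_zero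
  -- The identity also holds for degenerate `n` with `a n * √(V n) = 0`, since division by zero
  -- gives zero on both sides.
  have hZexp : ∀ n (t : ℝ) ω, Real.exp (t * ((1 / a n) * ((N n ω - m n) / √(V n)))) =
      Real.exp (-(t / (a n * √(V n)) * m n)) * Real.exp (t / (a n * √(V n)) * N n ω) := by
    intro n t ω
    rw [← Real.exp_add]; congr 1; field_simp; ring
  refine satisfiesLDP_of_tendsto_cgf hs (fun n => by fun_prop) (fun n t => ?_) fun θ => ?_
  · simp_rw [hZexp]
    exact ((h n).integrable_exp _).const_mul _
  · have hcgf : ∀ n t, cgf (fun ω => (1 / a n) * ((N n ω - m n) / √(V n))) (P n) t =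
        cgf (N n) (P n) (t / (a n * √(V n))) - m n * (t / (a n * √(V n))) := by
      intro n t
      rw [cgf, mgf]
      simp_rw [hZexp]
      rw [integral_const_mul, ← mgf, Real.log_mul (Real.exp_pos _).ne'
        (mgf_pos ((h n).integrable_exp _)).ne', Real.log_exp, cgf]
      ring
    have hsmall : Tendsto (fun n => θ * (a n / √(V n))) atTop (𝓝 0) := by
      simpa using hratio.const_mul θ
    have hbound : Tendsto (fun n => 2 * |θ| ^ 3 * |a n / √(V n)|) atTop (𝓝 0) := by
      simpa using hratio.abs.const_mul (2 * |θ| ^ 3)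
    have hev : ∀ᶠ n in atTop, |a n| ≤ √(V n) := by
      filter_upwards [ha₂.bound one_pos] with n hn
      simpa [abs_of_nonneg (Real.sqrt_nonneg _)] using hn
    refine tendsto_of_tendsto_of_dist (tendsto_const_nhds (x := θ ^ 2 / 2)) ?_
    refine squeeze_zero' (Eventually.of_forall fun n => dist_nonneg) ?_ hbound
    filter_upwards [hev, habs.eventually_gt_atTop 0,
      hsmall.abs.eventually_le_const (by norm_num : |(0 : ℝ)| < 1)] with n h1 h2 h3
    have ha : a n ≠ 0 := abs_pos.1 h2
    have hVs : 0 < √(V n) := h2.trans_le h1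
    have hVp : 0 < V n := Real.sqrt_pos.1 hVs
    -- The tilt `θ a²` of the normalised variable is the tilt `θ a / √V` of the count, which tends
    -- to zero. The quadratic term then equals `a² θ² / 2` exactly, and the cubic error divided by
    -- `a²` is `2 |θ|³ |a / √V|`.
    have e1 : θ * a n ^ 2 / (a n * √(V n)) = θ * (a n / √(V n)) := by field_simp
    rw [hcgf, e1]
    have key := (h n).abs_cgf_sub_le h3
    rw [← hm, ← hV] at key
    have hV2 : V n = √(V n) ^ 2 := (Real.sq_sqrt hVp.le).symm
    have e2 : V n * (θ * (a n / √(V n))) ^ 2 / 2 = a n ^ 2 * (θ ^ 2 / 2) := by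
      nth_rewrite 1 [hV2]; field_simp
    rw [e2] at key
    rw [dist_comm, Real.dist_eq]
    have e3 : (a n ^ 2)⁻¹ * (cgf (N n) (P n) (θ * (a n / √(V n))) - m n * (θ * (a n / √(V n)))) -
        θ ^ 2 / 2 = (a n ^ 2)⁻¹ * (cgf (N n) (P n) (θ * (a n / √(V n))) -
          m n * (θ * (a n / √(V n))) - a n ^ 2 * (θ ^ 2 / 2)) := by field_simp
    rw [e3, abs_mul, abs_of_pos (by positivity : 0 < (a n ^ 2)⁻¹)]
    refine (mul_le_mul_of_nonneg_left key (by positivity)).trans_eq ?_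
    rw [abs_mul, abs_div, abs_of_pos hVs]
    nth_rewrite 1 [hV2]
    rw [← sq_abs (a n)]
    field_simp

end ModerateDeviations

/-! ### From factorial moments to Laplace transforms -/

section FactorialMoments

variable {ι : Type*}

/-- The elementary symmetric function of degree `k` in the numbers `η j`, `j ∈ F`. -/
def elemSymm (η : ι → ℝ) (F : Finset ι) (k : ℕ) : ℝ := ∑ t ∈ F.powersetCard k, ∏ j ∈ t, η j

lemma elemSymm_nonneg {η : ι → ℝ} (hη : ∀ j, 0 ≤ η j) (F : Finset ι) (k : ℕ) :
    0 ≤ elemSymm η F k :=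
  Finset.sum_nonneg fun _ _ => Finset.prod_nonneg fun j _ => hη j

lemma elemSymm_mono {η : ι → ℝ} (hη : ∀ j, 0 ≤ η j) (k : ℕ) :
    Monotone fun F => elemSymm η F k := fun _ _ h =>
  Finset.sum_le_sum_of_subset_of_nonneg (Finset.powersetCard_mono h)
    fun _ _ _ => Finset.prod_nonneg fun j _ => hη j

lemma hasSum_pow_mul_elemSymm (η : ι → ℝ) (F : Finset ι) (w : ℝ) :
    HasSum (fun k => w ^ k * elemSymm η F k) (∏ j ∈ F, (1 + w * η j)) := by
  have h : ∏ j ∈ F, (1 + w * η j) =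
      ∑ k ∈ Finset.range (F.card + 1), w ^ k * elemSymm η F k := by
    rw [Finset.prod_one_add, Finset.sum_powerset]
    refine Finset.sum_congr rfl fun k _ => ?_
    rw [elemSymm, Finset.mul_sum]
    refine Finset.sum_congr rfl fun t ht => ?_
    rw [Finset.prod_mul_distrib, Finset.prod_const, (Finset.mem_powersetCard.1 ht).2]
  rw [h]
  refine hasSum_sum_of_ne_finset_zero fun k hk => ?_
  rw [elemSymm, Finset.powersetCard_eq_empty.2 (by simpa using hk)]
  simp

lemma elemSymm_one (η : ι → ℝ) (F : Finset ι) : elemSymm η F 1 = ∑ j ∈ F, η j := by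
  simp [elemSymm, Finset.powersetCard_one]

lemma two_mul_elemSymm_two (η : ι → ℝ) (F : Finset ι) :
    2 * elemSymm η F 2 = (∑ j ∈ F, η j) ^ 2 - ∑ j ∈ F, η j ^ 2 := by
  classical
  induction F using Finset.induction_on with
  | empty => simp [elemSymm, Finset.powersetCard_eq_empty.2 (by simp : (∅ : Finset ι).card < 2)]
  | insert a F ha ih =>
    have h : elemSymm η (insert a F) 2 = elemSymm η F 2 + η a * ∑ j ∈ F, η j := by
      rw [← elemSymm_one, elemSymm, Finset.powersetCard_succ_insert ha, Finset.sum_union,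
        Finset.sum_image, elemSymm, elemSymm, Finset.mul_sum]
      · congr 1
        refine Finset.sum_congr rfl fun t ht => ?_
        rw [Finset.prod_insert fun h => ha ((Finset.mem_powersetCard.1 ht).1 h)]
      · intro t ht t' ht' htt
        have h1 : a ∉ t := fun h => ha ((Finset.mem_powersetCard.1 ht).1 h)
        have h2 : a ∉ t' := fun h => ha ((Finset.mem_powersetCard.1 ht').1 h)
        rw [← Finset.erase_insert h1, htt, Finset.erase_insert h2]
      · rw [Finset.disjoint_left]
        intro t ht ht'
        obtain ⟨u, -, rfl⟩ := Finset.mem_image.1 ht'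
        exact ha ((Finset.mem_powersetCard.1 ht).1 (Finset.mem_insert_self a u))
    rw [h, Finset.sum_insert ha, Finset.sum_insert ha]
    linear_combination ih

/-- For every finite `F` the partial sums are at most `∏ (1 + w η j) ≤ exp (w ∑ η j)`, a bound
independent of `F`. -/
lemma summable_pow_mul_of_tendsto_elemSymm {η : ι → ℝ} (hη : ∀ j, 0 ≤ η j) (hs : Summable η)
    {E : ℕ → ℝ} (hE : ∀ k, Tendsto (fun F => elemSymm η F k) atTop (𝓝 (E k))) {w : ℝ}
    (hw : 0 ≤ w) : Summable fun k => w ^ k * E k := by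
  have hE0 : ∀ k, 0 ≤ E k := fun k => ge_of_tendsto' (hE k) fun F => elemSymm_nonneg hη F k
  refine summable_of_sum_range_le (c := Real.exp (w * ∑' j, η j))
    (fun k => mul_nonneg (pow_nonneg hw k) (hE0 k)) fun n => ?_
  refine le_of_tendsto' (tendsto_finsetSum _ fun k _ => (hE k).const_mul (w ^ k)) fun F => ?_
  calc ∑ k ∈ Finset.range n, w ^ k * elemSymm η F k ≤ ∏ j ∈ F, (1 + w * η j) :=
        sum_le_hasSum _ (fun k _ => mul_nonneg (pow_nonneg hw k) (elemSymm_nonneg hη F k))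
          (hasSum_pow_mul_elemSymm η F w)
    _ ≤ ∏ j ∈ F, Real.exp (w * η j) := by
        refine Finset.prod_le_prod (fun j _ => by have := hη j; positivity) fun j _ => ?_
        rw [add_comm]; exact Real.add_one_le_exp _
    _ = Real.exp (w * ∑ j ∈ F, η j) := by rw [← Real.exp_sum, Finset.mul_sum]
    _ ≤ _ := by
        gcongr
        exact hs.sum_le_tsum F fun j _ => hη j

/-- Dominated convergence for series: the elementary symmetric functions increase with `F`, so their
limits serve as the dominating sequence. -/
lemma tendsto_prod_one_add_mul {η : ι → ℝ} (hη : ∀ j, 0 ≤ η j) (hs : Summable η)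
    {E : ℕ → ℝ} (hE : ∀ k, Tendsto (fun F => elemSymm η F k) atTop (𝓝 (E k))) (w : ℝ) :
    Tendsto (fun F : Finset ι => ∏ j ∈ F, (1 + w * η j)) atTop (𝓝 (∑' k, w ^ k * E k)) := by
  simp_rw [← (hasSum_pow_mul_elemSymm η _ w).tsum_eq]
  refine tendsto_tsum_of_dominated_convergence
    (summable_pow_mul_of_tendsto_elemSymm hη hs hE (abs_nonneg w))
    (fun k => (hE k).const_mul (w ^ k)) (Eventually.of_forall fun F k => ?_)
  rw [norm_mul, norm_pow, Real.norm_eq_abs, Real.norm_of_nonneg (elemSymm_nonneg hη F k)]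
  gcongr
  exact (elemSymm_mono hη k).ge_of_tendsto (hE k) F

lemma hasSum_choose_mul_pow (m : ℕ) (w : ℝ) :
    HasSum (fun k => w ^ k * (m.choose k : ℝ)) ((1 + w) ^ m) := by
  rw [add_comm, add_pow]
  simp only [one_pow, mul_one]
  refine hasSum_sum_of_ne_finset_zero fun k hk => ?_
  rw [Nat.choose_eq_zero_of_lt (by simpa using hk)]
  simp

variable {Ω : Type*} [MeasurableSpace Ω] {P : Measure Ω}

lemma measurable_choose {M : Ω → ℕ} (hM : Measurable M) (k : ℕ) :
    Measurable fun ω => ((M ω).choose k : ℝ) :=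
  (measurable_from_nat (f := fun m => (m.choose k : ℝ))).comp hM

lemma integrable_choose {M : Ω → ℕ} (hM : Measurable M) {k : ℕ} {e : ℝ}
    (h : ∫⁻ ω, ((M ω).choose k : ℝ≥0∞) ∂P = ENNReal.ofReal e) :
    Integrable (fun ω => ((M ω).choose k : ℝ)) P := by
  refine ⟨(measurable_choose hM k).aestronglyMeasurable, ?_⟩
  rw [hasFiniteIntegral_iff_ofReal (Eventually.of_forall fun ω => by positivity)]
  simp only [ENNReal.ofReal_natCast]
  rw [h]; exact ENNReal.ofReal_lt_top

lemma integral_choose {M : Ω → ℕ} (hM : Measurable M) {k : ℕ} {e : ℝ} (he : 0 ≤ e)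
    (h : ∫⁻ ω, ((M ω).choose k : ℝ≥0∞) ∂P = ENNReal.ofReal e) :
    ∫ ω, ((M ω).choose k : ℝ) ∂P = e := by
  rw [integral_eq_lintegral_of_nonneg_ae (Eventually.of_forall fun ω => by positivity)
    (measurable_choose hM k).aestronglyMeasurable]
  simp only [ENNReal.ofReal_natCast]
  rw [h, ENNReal.toReal_ofReal he]

variable [IsProbabilityMeasure P]

/-- The factorial moments determine the Laplace transform. -/
theorem hasBernoulliMGF_of_choose {M : Ω → ℕ} (hM : Measurable M) {η : ι → ℝ}
    (hη : ∀ j, η j ∈ Set.Icc (0 : ℝ) 1) (hs : Summable η) {E : ℕ → ℝ}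
    (hE : ∀ k, Tendsto (fun F => elemSymm η F k) atTop (𝓝 (E k)))
    (hME : ∀ k, ∫⁻ ω, ((M ω).choose k : ℝ≥0∞) ∂P = ENNReal.ofReal (E k)) :
    HasBernoulliMGF (fun ω => (M ω : ℝ)) P η := by
  have hη0 : ∀ j, 0 ≤ η j := fun j => (hη j).1
  have hE0 : ∀ k, 0 ≤ E k := fun k => ge_of_tendsto' (hE k) fun F => elemSymm_nonneg hη0 F k
  have hint : ∀ k, Integrable (fun ω => ((M ω).choose k : ℝ)) P := fun k =>
    integrable_choose hM (hME k)
  have hval : ∀ k, ∫ ω, ((M ω).choose k : ℝ) ∂P = E k := fun k =>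
    integral_choose hM (hE0 k) (hME k)
  have hnorm : ∀ (w : ℝ) k, ∫ ω, ‖w ^ k * ((M ω).choose k : ℝ)‖ ∂P = |w| ^ k * E k := by
    intro w k
    simp_rw [norm_mul, norm_pow, Real.norm_eq_abs, Nat.abs_cast]
    rw [integral_const_mul, hval]
  -- With `w = e^s - 1`, the binomial theorem makes `e^{sM} = (1 + w)^M` the generating series of
  -- the numbers `M.choose k`.
  have hexp : ∀ (s : ℝ) ω, Real.exp (s * (M ω : ℝ)) = (1 + (Real.exp s - 1)) ^ M ω := by
    intro s ω
    rw [add_sub_cancel, ← Real.exp_nat_mul, mul_comm]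
  have hmgf : ∀ s : ℝ, mgf (fun ω => (M ω : ℝ)) P s = ∑' k, (Real.exp s - 1) ^ k * E k := by
    intro s
    have h := hasSum_integral_of_summable_integral_norm (μ := P)
      (F := fun k ω => (Real.exp s - 1) ^ k * ((M ω).choose k : ℝ))
      (fun k => (hint k).const_mul _) (by
        simp_rw [hnorm]
        exact summable_pow_mul_of_tendsto_elemSymm hη0 hs hE (abs_nonneg _))
    simp_rw [integral_const_mul, hval] at h
    rw [h.tsum_eq, mgf]
    refine integral_congr_ae (Eventually.of_forall fun ω => ?_)
    simp only
    rw [hexp, (hasSum_choose_mul_pow _ _).tsum_eq]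
  have hmeasE : ∀ s : ℝ, AEStronglyMeasurable (fun ω => Real.exp (s * (M ω : ℝ))) P := fun s =>
    ((measurable_from_nat (f := fun m : ℕ => Real.exp (s * m))).comp hM).aestronglyMeasurable
  refine ⟨hη, hs, fun s => ?_, fun s => ?_⟩
  -- For `s ≤ 0` the exponential is at most `1`. For `s ≥ 0` all terms of the binomial series are
  -- nonnegative, so Tonelli gives integrability.
  · rcases le_total s 0 with h | h
    · refine Integrable.of_bound (hmeasE s) 1 (Eventually.of_forall fun ω => ?_)
      rw [Real.norm_of_nonneg (Real.exp_pos _).le, Real.exp_le_one_iff]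
      exact mul_nonpos_of_nonpos_of_nonneg h (Nat.cast_nonneg _)
    · have hw : 0 ≤ Real.exp s - 1 := by linarith [Real.one_le_exp h]
      refine ⟨hmeasE s, ?_⟩
      rw [hasFiniteIntegral_iff_ofReal (Eventually.of_forall fun ω => (Real.exp_pos _).le)]
      have h1 : ∀ ω, ENNReal.ofReal (Real.exp (s * (M ω : ℝ))) =
          ∑' k, ENNReal.ofReal ((Real.exp s - 1) ^ k) * ((M ω).choose k : ℝ≥0∞) := by
        intro ω
        have h2 := hasSum_choose_mul_pow (M ω) (Real.exp s - 1)
        rw [hexp, ← h2.tsum_eq, ENNReal.ofReal_tsum_of_nonneg (fun k => by positivity) h2.summable]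
        refine tsum_congr fun k => ?_
        rw [ENNReal.ofReal_mul (by positivity), ENNReal.ofReal_natCast]
      simp_rw [h1]
      have hm' : ∀ k, Measurable fun ω => ((M ω).choose k : ℝ≥0∞) := fun k =>
        (measurable_from_nat (f := fun m => (m.choose k : ℝ≥0∞))).comp hM
      rw [lintegral_tsum fun k => ((hm' k).const_mul _).aemeasurable]
      simp_rw [lintegral_const_mul _ (hm' _), hME, ← ENNReal.ofReal_mul (pow_nonneg hw _)]
      rw [← ENNReal.ofReal_tsum_of_nonneg (fun k => mul_nonneg (pow_nonneg hw _) (hE0 k))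
        (summable_pow_mul_of_tendsto_elemSymm hη0 hs hE hw)]
      exact ENNReal.ofReal_lt_top
  · rw [hmgf]
    refine (tendsto_prod_one_add_mul hη0 hs hE _).congr fun F => Finset.prod_congr rfl fun j _ => ?_
    ring

/-- Mean and variance in terms of the first two factorial moments. -/
theorem memLp_two_and_variance_of_choose {M : Ω → ℕ} (hM : Measurable M) {η : ι → ℝ}
    (hη : ∀ j, η j ∈ Set.Icc (0 : ℝ) 1) (hs : Summable η) {E : ℕ → ℝ}
    (hE : ∀ k, Tendsto (fun F => elemSymm η F k) atTop (𝓝 (E k)))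
    (hME : ∀ k, ∫⁻ ω, ((M ω).choose k : ℝ≥0∞) ∂P = ENNReal.ofReal (E k)) :
    MemLp (fun ω => (M ω : ℝ)) 2 P ∧ ∫ ω, (M ω : ℝ) ∂P = ∑' j, η j ∧
      variance (fun ω => (M ω : ℝ)) P = ∑' j, η j * (1 - η j) := by
  have hη0 : ∀ j, 0 ≤ η j := fun j => (hη j).1
  have hE0 : ∀ k, 0 ≤ E k := fun k => ge_of_tendsto' (hE k) fun F => elemSymm_nonneg hη0 F k
  have hint : ∀ k, Integrable (fun ω => ((M ω).choose k : ℝ)) P := fun k =>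
    integrable_choose hM (hME k)
  have hval : ∀ k, ∫ ω, ((M ω).choose k : ℝ) ∂P = E k := fun k =>
    integral_choose hM (hE0 k) (hME k)
  have hs2 : Summable fun j => η j ^ 2 :=
    Summable.of_nonneg_of_le (fun j => sq_nonneg _)
      (fun j => by nlinarith [(hη j).1, (hη j).2]) hs
  have hE1 : E 1 = ∑' j, η j :=
    tendsto_nhds_unique (hE 1) (by simp_rw [elemSymm_one]; exact hs.hasSum)
  have hE2 : 2 * E 2 = (∑' j, η j) ^ 2 - ∑' j, η j ^ 2 := by
    refine tendsto_nhds_unique ((hE 2).const_mul 2) ?_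
    simp_rw [two_mul_elemSymm_two]
    exact (Tendsto.pow hs.hasSum 2).sub hs2.hasSum
  have hsq : ∀ ω, (M ω : ℝ) ^ 2 = 2 * ((M ω).choose 2 : ℝ) + ((M ω).choose 1 : ℝ) := by
    intro ω
    rw [Nat.cast_choose_two, Nat.choose_one_right]; ring
  have hmean : ∫ ω, (M ω : ℝ) ∂P = ∑' j, η j := by
    rw [← hE1, ← hval 1]; simp
  have hmem : MemLp (fun ω => (M ω : ℝ)) 2 P := by
    rw [memLp_two_iff_integrable_sq (by simpa using (measurable_choose hM 1).aestronglyMeasurable)]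
    simp_rw [hsq]
    exact ((hint 2).const_mul 2).add (hint 1)
  refine ⟨hmem, hmean, ?_⟩
  rw [variance_eq_sub hmem]
  simp only [Pi.pow_apply]
  simp_rw [hsq]
  rw [integral_add ((hint 2).const_mul 2) (hint 1), integral_const_mul, hval, hval, hmean, hE2, hE1]
  simp_rw [mul_sub, mul_one, ← sq]
  rw [hs.tsum_sub hs2]
  ring

end FactorialMoments

/-! ### Factorial moments of counting variables -/

section Counting

/-- When every cell holds at most one point, a product is `1` exactly if all chosen cells are
occupied, so the sum counts the injections of `Fin k` into the occupied cells. -/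
lemma sum_embedding_prod_eq_descFactorial {α : Type*} [Fintype α] (m : α → ℕ)
    (hm : ∀ c, m c ≤ 1) (k : ℕ) :
    ∑ σ : Fin k ↪ α, ∏ i, m (σ i) = (∑ c, m c).descFactorial k := by
  classical
  have hm' : ∀ c, m c = if m c = 1 then 1 else 0 := by
    intro c
    have := hm c
    split_ifs with h
    · exact h
    · omega
  have h1 : ∑ c, m c = Fintype.card {c // m c = 1} := by
    rw [Finset.sum_congr rfl fun c _ => hm' c, Finset.sum_boole, Fintype.card_subtype]
    simp
  have h2 : ∀ σ : Fin k ↪ α, ∏ i, m (σ i) = if ∀ i, m (σ i) = 1 then 1 else 0 := by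
    intro σ
    split_ifs with h
    · exact Finset.prod_eq_one fun i _ => h i
    · push Not at h
      obtain ⟨i, hi⟩ := h
      exact Finset.prod_eq_zero (Finset.mem_univ i) (by have := hm (σ i); omega)
  rw [Finset.sum_congr rfl fun σ _ => h2 σ, Finset.sum_boole, h1, ← Fintype.card_subtype, Nat.cast_id]
  have e : {σ : Fin k ↪ α // ∀ i, m (σ i) = 1} ≃ (Fin k ↪ {c // m c = 1}) :=
    { toFun := fun σ => ⟨fun i => ⟨σ.1 i, σ.2 i⟩, fun i j h => σ.1.injective (congrArg Subtype.val h)⟩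
      invFun := fun τ => ⟨τ.trans (Function.Embedding.subtype _), fun i => (τ i).2⟩
      left_inv := fun σ => by ext; rfl
      right_inv := fun τ => by ext; rfl }
  rw [Fintype.card_congr e, Fintype.card_embedding_eq, Fintype.card_fin]

variable {Λ : Type*} [MeasurableSpace Λ] [MeasurableSpace.CountablyGenerated Λ]

/-- The first `n` binary digits of the image of a point in Cantor space. -/
def cantorCode (n : ℕ) (x : Λ) : Fin n → Bool := fun i => MeasurableSpace.mapNatBool Λ x i

lemma measurable_cantorCode (n : ℕ) : Measurable (cantorCode (Λ := Λ) n) :=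
  measurable_pi_lambda _ fun i =>
    (measurable_pi_apply (i : ℕ)).comp (MeasurableSpace.measurable_mapNatBool Λ)

lemma cantorCode_eq_of_le {n m : ℕ} (h : n ≤ m) {x y : Λ} (hxy : cantorCode m x = cantorCode m y) :
    cantorCode n x = cantorCode n y :=
  funext fun i => congrFun hxy (Fin.castLE h i)

lemma eq_of_forall_cantorCode_eq [MeasurableSpace.SeparatesPoints Λ] {x y : Λ}
    (h : ∀ n, cantorCode n x = cantorCode n y) : x = y :=
  MeasurableSpace.injective_mapNatBool Λ (funext fun i => congrFun (h (i + 1)) (Fin.last i))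

/-- The part of `D` in which the first `n` binary digits are given by `c`. -/
def cantorCell (D : Set Λ) (n : ℕ) (c : Fin n → Bool) : Set Λ := cantorCode n ⁻¹' {c} ∩ D

lemma measurableSet_cantorCell {D : Set Λ} (hD : MeasurableSet D) (n : ℕ) (c : Fin n → Bool) :
    MeasurableSet (cantorCell D n c) :=
  (measurable_cantorCode n (measurableSet_singleton c)).inter hD

lemma cantorCell_subset (D : Set Λ) (n : ℕ) (c : Fin n → Bool) : cantorCell D n c ⊆ D :=
  Set.inter_subset_right

lemma disjoint_cantorCell (D : Set Λ) (n : ℕ) {c c' : Fin n → Bool} (h : c ≠ c') :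
    Disjoint (cantorCell D n c) (cantorCell D n c') := by
  rw [Set.disjoint_left]
  rintro x ⟨hx, -⟩ ⟨hx', -⟩
  exact h (hx.symm.trans hx')

lemma sum_measure_cantorCell (ν : Measure Λ) {D : Set Λ} (hD : MeasurableSet D) (n : ℕ) :
    ∑ c, ν (cantorCell D n c) = ν D := by
  rw [← measure_biUnion_finset (fun c _ c' _ h => disjoint_cantorCell D n h)
    fun c _ => measurableSet_cantorCell hD n c]
  congr 1
  ext x
  simp [cantorCell]

/-- Tuples of points of `D` that are separated by the first `n` binary digits. -/
def separatedTuples (D : Set Λ) (k n : ℕ) : Set (Fin k → Λ) :=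
  {x | (∀ i, x i ∈ D) ∧ Function.Injective fun i => cantorCode n (x i)}

lemma separatedTuples_eq_iUnion (D : Set Λ) (k n : ℕ) :
    separatedTuples D k n =
      ⋃ σ : Fin k ↪ (Fin n → Bool), Set.univ.pi fun i => cantorCell D n (σ i) := by
  ext x
  simp only [separatedTuples, Set.mem_iUnion, Set.mem_pi, cantorCell]
  constructor
  · rintro ⟨h1, h2⟩
    exact ⟨⟨_, h2⟩, fun i _ => ⟨rfl, h1 i⟩⟩
  · rintro ⟨σ, hσ⟩
    refine ⟨fun i => (hσ i trivial).2, fun i j hij => σ.injective ?_⟩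
    rw [← (hσ i trivial).1, ← (hσ j trivial).1]
    exact hij

lemma measurableSet_separatedTuples {D : Set Λ} (hD : MeasurableSet D) (k n : ℕ) :
    MeasurableSet (separatedTuples D k n) := by
  rw [separatedTuples_eq_iUnion]
  exact MeasurableSet.iUnion fun σ =>
    MeasurableSet.univ_pi fun i => measurableSet_cantorCell hD n _

lemma measure_separatedTuples {D : Set Λ} (hD : MeasurableSet D) (k n : ℕ)
    (m : Measure (Fin k → Λ)) :
    m (separatedTuples D k n) =
      ∑ σ : Fin k ↪ (Fin n → Bool), m (Set.univ.pi fun i => cantorCell D n (σ i)) := by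
  rw [separatedTuples_eq_iUnion, measure_iUnion, tsum_fintype]
  · intro σ τ h
    obtain ⟨i, hi⟩ := DFunLike.ne_iff.1 h
    exact Set.disjoint_univ_pi.2 ⟨i, disjoint_cantorCell D n hi⟩
  · exact fun σ => MeasurableSet.univ_pi fun i => measurableSet_cantorCell hD n _

lemma monotone_separatedTuples (D : Set Λ) (k : ℕ) : Monotone (separatedTuples D k) :=
  fun _ _ h _ hx => ⟨hx.1, fun _ _ hij => hx.2 (cantorCode_eq_of_le h hij)⟩

lemma iUnion_separatedTuples [MeasurableSpace.SeparatesPoints Λ] (D : Set Λ) (k : ℕ) :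
    ⋃ n, separatedTuples D k n = {x | (∀ i, x i ∈ D) ∧ Function.Injective x} := by
  ext x
  simp only [Set.mem_iUnion]
  constructor
  · rintro ⟨n, h1, h2⟩
    exact ⟨h1, fun i j hij => h2 (congrArg (cantorCode n) hij)⟩
  · rintro ⟨h1, h2⟩
    have h3 : ∀ i j, ∃ n, i ≠ j → cantorCode n (x i) ≠ cantorCode n (x j) := by
      intro i j
      by_cases h : i = j
      · exact ⟨0, fun h' => (h' h).elim⟩
      · by_contra! hcon
        exact h (h2 (eq_of_forall_cantorCode_eq fun n => (hcon n).2))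
    choose N hN using h3
    refine ⟨∑ i, ∑ j, N i j, h1, fun i j hij => ?_⟩
    by_contra hne
    refine hN i j hne (cantorCode_eq_of_le ?_ hij)
    exact (Finset.single_le_sum (f := fun j => N i j) (fun _ _ => Nat.zero_le _)
      (Finset.mem_univ j)).trans (Finset.single_le_sum (f := fun i => ∑ j, N i j)
        (fun _ _ => Nat.zero_le _) (Finset.mem_univ i))

/-- The sum is the `ν × ν`-measure of the pairs in `D` with the same first `n` digits. These sets
decrease to the diagonal, whose measure is `∫_D ν {x} dν(x) ≤ ν D` by simplicity. -/
lemma eventually_sum_sq_cantorCell_lt [MeasurableSpace.SeparatesPoints Λ] {ν : Measure Λ}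
    {D : Set Λ} (hfin : ν D ≠ ∞) (hsimple : ∀ x, ν {x} ≤ 1) :
    ∀ᶠ n in atTop, ∑ c, ν (cantorCell D n c) * ν (cantorCell D n c) < ν D + 1 := by
  have : IsFiniteMeasure (ν.restrict D) := ⟨by simpa using hfin.lt_top⟩
  set B : ℕ → Set (Λ × Λ) := fun n => {p | cantorCode n p.1 = cantorCode n p.2} with hB
  have hBm : ∀ n, MeasurableSet (B n) := fun n =>
    measurableSet_eq_fun ((measurable_cantorCode n).comp measurable_fst)
      ((measurable_cantorCode n).comp measurable_snd)
  have hBanti : Antitone B := fun n m h p hp => cantorCode_eq_of_le h hp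
  have hBi : ⋂ n, B n = Set.diagonal Λ := by
    ext p
    simp only [hB, Set.mem_iInter, Set.mem_diagonal_iff]
    exact ⟨fun h => eq_of_forall_cantorCode_eq h, fun h n => congrArg _ h⟩
  have hlim := tendsto_measure_iInter_atTop (μ := (ν.restrict D).prod (ν.restrict D))
    (fun n => (hBm n).nullMeasurableSet) hBanti ⟨0, measure_ne_top _ _⟩
  have hdiag : MeasurableSet (Set.diagonal Λ) := hBi ▸ MeasurableSet.iInter hBm
  have hle : ((ν.restrict D).prod (ν.restrict D)) (⋂ n, B n) ≤ ν D := by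
    rw [hBi, Measure.prod_apply hdiag]
    calc _ ≤ ∫⁻ _, 1 ∂(ν.restrict D) := by
          refine lintegral_mono fun x => ?_
          have : Prod.mk x ⁻¹' Set.diagonal Λ = {x} := by ext; simp [eq_comm]
          rw [this]
          exact (Measure.restrict_apply_le _ _).trans (hsimple x)
      _ = ν D := by simp
  have hBn : ∀ n, ((ν.restrict D).prod (ν.restrict D)) (B n) =
      ∑ c, ν (cantorCell D n c) * ν (cantorCell D n c) := by
    intro n
    have h1 : B n = ⋃ c ∈ (Finset.univ : Finset (Fin n → Bool)),
        (cantorCode n ⁻¹' {c}) ×ˢ (cantorCode n ⁻¹' {c}) := by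
      ext p
      simp [hB, eq_comm]
    have hcm : ∀ c, MeasurableSet (cantorCode (Λ := Λ) n ⁻¹' {c}) := fun c =>
      measurable_cantorCode n (measurableSet_singleton c)
    rw [h1, measure_biUnion_finset]
    · refine Finset.sum_congr rfl fun c _ => ?_
      rw [Measure.prod_prod, Measure.restrict_apply (hcm c), cantorCell]
    · intro c _ c' _ h
      refine Set.disjoint_prod.2 (Or.inl ?_)
      rw [Set.disjoint_left]
      exact fun x hx hx' => h (hx.symm.trans hx')
    · exact fun c _ => (hcm c).prod (hcm c)
  simp_rw [← hBn]
  exact hlim.eventually_lt_const (hle.trans_lt (ENNReal.lt_add_right hfin one_ne_zero))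

/-- The cell counts are natural numbers with sum `N` and, eventually, sum of squares below `N + 1`.
Hence no count exceeds `1`: the partition separates the points. -/
lemma eventually_sum_embedding_prod_cantorCell [MeasurableSpace.SeparatesPoints Λ]
    {ν : Measure Λ} {D : Set Λ} (hD : MeasurableSet D) {N : ℕ} (hN : ν D = N)
    (hint : ∀ B, MeasurableSet B → ∃ m : ℕ∞, ν B = (m : ℝ≥0∞))
    (hsimple : ∀ x, ν {x} ≤ 1) (k : ℕ) :
    ∀ᶠ n in atTop, ∑ σ : Fin k ↪ (Fin n → Bool), ∏ i, ν (cantorCell D n (σ i)) =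
      (N.descFactorial k : ℝ≥0∞) := by
  filter_upwards [eventually_sum_sq_cantorCell_lt (D := D) (by simp [hN]) hsimple] with n hn
  have hnat : ∀ c, ∃ m : ℕ, ν (cantorCell D n c) = m := by
    intro c
    obtain ⟨m, hm⟩ := hint _ (measurableSet_cantorCell hD n c)
    induction m with
    | top =>
      exfalso
      have := measure_mono (μ := ν) (cantorCell_subset D n c)
      rw [hm, hN] at this
      simp at this
    | coe m => exact ⟨m, by simpa using hm⟩
  choose m hm using hnat
  have hsum : ∑ c, m c = N := by
    have := sum_measure_cantorCell ν hD n
    simp_rw [hm, hN] at this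
    exact_mod_cast this
  have hsq : ∑ c, m c * m c < N + 1 := by
    simp_rw [hm, hN] at hn
    exact_mod_cast hn
  have hm1 : ∀ c, m c ≤ 1 := by
    by_contra! hcon
    obtain ⟨c, hc⟩ := hcon
    have : ∑ c, m c < ∑ c, m c * m c :=
      Finset.sum_lt_sum (fun c _ => Nat.le_mul_self _) ⟨c, Finset.mem_univ c, by nlinarith⟩
    omega
  simp_rw [hm]
  rw [← hsum, ← sum_embedding_prod_eq_descFactorial m hm1 k]
  push_cast
  rfl

end Counting

/-! ### Factorial moments as integrals of joint intensities -/

section PointProcess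

variable {Λ Ω : Type*} [TopologicalSpace Λ] [MeasurableSpace Λ]
  [MeasurableSpace.CountablyGenerated Λ] [MeasurableSpace.SeparatesPoints Λ] [MeasurableSpace Ω]

/-- Factorial moments of the number of points in `D`. -/
theorem IsSimplePointProcess.lintegral_descFactorial {P : Measure Ω} {χ : Ω → Measure Λ}
    (hχ : IsSimplePointProcess P χ) {μ : Measure Λ} [SigmaFinite μ] {k : ℕ}
    {ρ : (Fin k → Λ) → ℝ} (hρ : IsJointIntensity P χ μ k ρ) {D : Set Λ} (hD : MeasurableSet D)
    {M : Ω → ℕ} (hM : ∀ᵐ ω ∂P, χ ω D = M ω) :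
    ∫⁻ ω, ((M ω).descFactorial k : ℝ≥0∞) ∂P =
      ∫⁻ x in {x | (∀ i, x i ∈ D) ∧ Function.Injective x}, ENNReal.ofReal (ρ x)
        ∂(Measure.pi fun _ => μ) := by
  set m := (Measure.pi fun _ : Fin k => μ).withDensity fun x => ENNReal.ofReal (ρ x) with hm
  have hmeasχ : ∀ n c, Measurable fun ω => χ ω (cantorCell D n c) := fun n c =>
    (Measure.measurable_coe (measurableSet_cantorCell hD n c)).comp hχ.measurable
  -- Joint intensities describe only products over disjoint sets, so level `n` sees exactly the
  -- tuples whose points lie in distinct cells.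
  have hlevel : ∀ n, ∫⁻ ω, ∑ σ : Fin k ↪ (Fin n → Bool), ∏ i, χ ω (cantorCell D n (σ i)) ∂P =
      m (separatedTuples D k n) := by
    intro n
    rw [measure_separatedTuples hD, lintegral_finsetSum _ fun σ _ =>
      Finset.measurable_prod _ fun i _ => hmeasχ n (σ i)]
    refine Finset.sum_congr rfl fun σ _ => ?_
    rw [hρ.lintegral_eq _ (fun i => measurableSet_cantorCell hD n _)
      (fun i j hij => disjoint_cantorCell D n (σ.injective.ne hij)), hm, withDensity_apply _
      (MeasurableSet.univ_pi fun i => measurableSet_cantorCell hD n _)]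
  have hAm : MeasurableSet {x : Fin k → Λ | (∀ i, x i ∈ D) ∧ Function.Injective x} := by
    rw [← iUnion_separatedTuples]
    exact MeasurableSet.iUnion fun n => measurableSet_separatedTuples hD k n
  have hright : Tendsto (fun n => m (separatedTuples D k n)) atTop
      (𝓝 (m {x | (∀ i, x i ∈ D) ∧ Function.Injective x})) := by
    rw [← iUnion_separatedTuples]
    exact tendsto_measure_iUnion_atTop (monotone_separatedTuples D k)
  rw [← withDensity_apply _ hAm, ← hm]
  refine tendsto_nhds_unique ?_ hright
  simp_rw [← hlevel]
  refine lintegral_tendsto_of_tendsto_of_monotone (fun n => (Finset.measurable_sum _ fun σ _ =>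
    Finset.measurable_prod _ fun i _ => hmeasχ n (σ i)).aemeasurable) ?_ ?_
  · filter_upwards [hM] with ω hω
    have : IsFiniteMeasure ((χ ω).restrict D) := ⟨by simp [hω]⟩
    -- Reading the sum as a product measure of the separated tuples shows that it increases with
    -- `n`, as monotone convergence requires.
    have h1 : ∀ n, ∑ σ : Fin k ↪ (Fin n → Bool), ∏ i, χ ω (cantorCell D n (σ i)) =
        (Measure.pi fun _ : Fin k => (χ ω).restrict D) (separatedTuples D k n) := by
      intro n
      rw [measure_separatedTuples hD]
      refine Finset.sum_congr rfl fun σ _ => ?_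
      rw [Measure.pi_pi]
      refine Finset.prod_congr rfl fun i _ => ?_
      rw [Measure.restrict_apply (measurableSet_cantorCell hD n _),
        Set.inter_eq_left.2 (cantorCell_subset D n _)]
    intro n n' h
    simp only [h1]
    exact measure_mono (monotone_separatedTuples D k h)
  · filter_upwards [hM, hχ.integerValued, hχ.simple] with ω h1 h2 h3
    exact tendsto_const_nhds.congr' ((eventually_sum_embedding_prod_cantorCell hD h1 h2 h3 k).mono
      fun n hn => hn.symm)

end PointProcess

/-! ### Integrals of determinants of kernels with an eigenfunction expansion -/

section InjectiveSums

open Classical in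
lemma card_filter_image_eq_factorial {ι : Type*} (F t : Finset ι) (htF : t ⊆ F) {k : ℕ}
    (ht : t.card = k) :
    ((Fintype.piFinset fun _ : Fin k => F).filter
      fun p => Function.Injective p ∧ Finset.univ.image p = t).card = k.factorial := by
  have h1 : (Finset.univ : Finset (Fin k ↪ t)).card = k.factorial := by
    rw [Finset.card_univ, Fintype.card_embedding_eq]
    simp [ht, Nat.descFactorial_self]
  rw [← h1]
  symm
  refine Finset.card_bij (fun τ _ i => (τ i : ι)) ?_ ?_ ?_
  · intro τ _
    have hinj : Function.Injective fun i => (τ i : ι) := Subtype.val_injective.comp τ.injective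
    refine Finset.mem_filter.2 ⟨Fintype.mem_piFinset.2 fun i => htF (τ i).2, hinj, ?_⟩
    refine Finset.eq_of_subset_of_card_le ?_ ?_
    · intro j hj
      obtain ⟨i, -, rfl⟩ := Finset.mem_image.1 hj
      exact (τ i).2
    · rw [Finset.card_image_of_injective _ hinj, Finset.card_univ, Fintype.card_fin, ht]
  · intro τ _ τ' _ h
    ext i
    exact congrFun h i
  · intro p hp
    obtain ⟨-, hinj, him⟩ := Finset.mem_filter.1 hp
    refine ⟨⟨fun i => ⟨p i, him ▸ Finset.mem_image_of_mem p (Finset.mem_univ i)⟩,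
      fun i j h => hinj (congrArg Subtype.val h)⟩, Finset.mem_univ _, rfl⟩

open Classical in
lemma sum_injective_prod_eq_elemSymm {ι : Type*} (η : ι → ℝ) (F : Finset ι) (k : ℕ) :
    ∑ p ∈ (Fintype.piFinset fun _ : Fin k => F).filter fun p => Function.Injective p,
      ∏ i, η (p i) = k.factorial * elemSymm η F k := by
  have hmaps : ∀ p ∈ (Fintype.piFinset fun _ : Fin k => F).filter fun p => Function.Injective p,
      Finset.univ.image p ∈ F.powersetCard k := by
    intro p hp
    obtain ⟨hpF, hinj⟩ := Finset.mem_filter.1 hp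
    refine Finset.mem_powersetCard.2 ⟨?_, by simp [Finset.card_image_of_injective _ hinj]⟩
    intro j hj
    obtain ⟨i, -, rfl⟩ := Finset.mem_image.1 hj
    exact Fintype.mem_piFinset.1 hpF i
  rw [← Finset.sum_fiberwise_of_maps_to hmaps, elemSymm, Finset.mul_sum]
  refine Finset.sum_congr rfl fun t ht => ?_
  obtain ⟨htF, htk⟩ := Finset.mem_powersetCard.1 ht
  rw [Finset.filter_filter, ← card_filter_image_eq_factorial F t htF htk, ← nsmul_eq_mul]
  refine Finset.sum_eq_card_nsmul fun p hp => ?_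
  obtain ⟨-, hinj, him⟩ := Finset.mem_filter.1 hp
  rw [← him, Finset.prod_image fun i _ j _ h => hinj h]

end InjectiveSums

section NonnegSeries

lemma integrable_tsum_of_nonneg {α ι : Type*} [MeasurableSpace α] [Countable ι] {m : Measure α}
    {f : ι → α → ℝ} (hf : ∀ j, Integrable (f j) m) (h0 : ∀ j x, 0 ≤ f j x)
    (hs : Summable fun j => ∫ x, f j x ∂m) :
    (∀ᵐ x ∂m, Summable fun j => f j x) ∧ Integrable (fun x => ∑' j, f j x) m := by
  have hlt : ∫⁻ x, ∑' j, ENNReal.ofReal (f j x) ∂m < ∞ := by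
    rw [lintegral_tsum fun j => (hf j).aestronglyMeasurable.aemeasurable.ennreal_ofReal]
    simp_rw [← ofReal_integral_eq_lintegral_ofReal (hf _) (Eventually.of_forall (h0 _))]
    rw [← ENNReal.ofReal_tsum_of_nonneg (fun j => integral_nonneg (h0 j)) hs]
    exact ENNReal.ofReal_lt_top
  have hsum : ∀ᵐ x ∂m, Summable fun j => f j x := by
    filter_upwards [ae_lt_top' (AEMeasurable.tsum fun j =>
      (hf j).aestronglyMeasurable.aemeasurable.ennreal_ofReal) hlt.ne] with x hx
    exact (ENNReal.summable_toReal hx.ne).congr fun j => ENNReal.toReal_ofReal (h0 j x)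
  refine ⟨hsum, ?_, ?_⟩
  · refine aestronglyMeasurable_of_tendsto_ae (u := (atTop : Filter (Finset ι)))
      (f := fun F x => ∑ j ∈ F, f j x)
      (fun F => (integrable_finsetSum F fun j _ => hf j).aestronglyMeasurable) ?_
    filter_upwards [hsum] with x hx using hx.hasSum
  · rw [hasFiniteIntegral_iff_ofReal (Eventually.of_forall fun x => tsum_nonneg fun j => h0 j x)]
    refine (lintegral_congr_ae ?_).trans_lt hlt
    filter_upwards [hsum] with x hx using ENNReal.ofReal_tsum_of_nonneg (fun j => h0 j x) hx

end NonnegSeries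

/-! ### Determinants of kernels with an orthonormal expansion -/

section DeterminantIntegrals

open ComplexConjugate

variable {Λ ι : Type*}

/-- The contribution of `j ∈ F` to the kernel `∑ⱼ ηⱼ φⱼ(x) conj (φⱼ(y))`. -/
def partialKernel (φ : ι → Λ → ℂ) (η : ι → ℝ) (F : Finset ι) (x y : Λ) : ℂ :=
  ∑ j ∈ F, (η j : ℂ) * (φ j x * conj (φ j y))

/-- Leibniz' formula with all products of sums multiplied out. The factors are reordered along `σ`
so that each variable `x i` sits in a single factor, and the integral of every term is a product of
inner products. -/
lemma det_partialKernel {φ : ι → Λ → ℂ} {η : ι → ℝ} (F : Finset ι) {k : ℕ} (x : Fin k → Λ) :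
    (Matrix.of fun i j => partialKernel φ η F (x i) (x j)).det =
      ∑ σ : Equiv.Perm (Fin k), ∑ p ∈ Fintype.piFinset fun _ : Fin k => F,
        ((σ.sign : ℤ) : ℂ) * ((∏ i, (η (p i) : ℂ)) *
          ∏ i, (φ (p (σ.symm i)) (x i) * conj (φ (p i) (x i)))) := by
  rw [Matrix.det_apply']
  refine Finset.sum_congr rfl fun σ _ => ?_
  simp only [Matrix.of_apply, partialKernel]
  rw [Finset.prod_univ_sum, Finset.mul_sum]
  refine Finset.sum_congr rfl fun p _ => ?_
  rw [Finset.prod_mul_distrib, Finset.prod_mul_distrib, Finset.prod_mul_distrib]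
  congr 3
  rw [← Equiv.prod_comp σ fun i => φ (p (σ.symm i)) (x i)]
  simp

variable [MeasurableSpace Λ]

/-- The kernel `K` is `∑ⱼ ηⱼ φⱼ(x) conj (φⱼ(y))` almost everywhere, on the diagonal as well as
off it, for an orthonormal family `φ`. -/
structure HasKernelExpansion (m : Measure Λ) (K : Λ → Λ → ℂ) (φ : ι → Λ → ℂ) (η : ι → ℝ) :
    Prop where
  memLp : ∀ j, MemLp (φ j) 2 m
  inner_self : ∀ j, ∫ x, φ j x * conj (φ j x) ∂m = 1
  inner_ne : ∀ i j, i ≠ j → ∫ x, φ i x * conj (φ j x) ∂m = 0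
  nonneg : ∀ j, 0 ≤ η j
  summable : Summable η
  diag : ∀ᵐ x ∂m, HasSum (fun j => (η j : ℂ) * (φ j x * conj (φ j x))) (K x x)
  offDiag : ∀ᵐ p ∂(m.prod m), HasSum (fun j => (η j : ℂ) * (φ j p.1 * conj (φ j p.2))) (K p.1 p.2)

lemma integrable_mul_conj {m : Measure Λ} {f g : Λ → ℂ} (hf : MemLp f 2 m) (hg : MemLp g 2 m) :
    Integrable (fun x => f x * conj (g x)) m :=
  hf.integrable_mul hg.star

variable {m : Measure Λ} [SigmaFinite m] {K : Λ → Λ → ℂ} {φ : ι → Λ → ℂ} {η : ι → ℝ}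

lemma integrable_det_partialKernel (hφ : ∀ j, MemLp (φ j) 2 m) (F : Finset ι) (k : ℕ) :
    Integrable (fun x : Fin k → Λ => (Matrix.of fun i j => partialKernel φ η F (x i) (x j)).det)
      (Measure.pi fun _ => m) := by
  simp_rw [det_partialKernel]
  refine integrable_finsetSum _ fun σ _ => integrable_finsetSum _ fun p _ =>
    Integrable.const_mul (Integrable.const_mul ?_ _) _
  exact Integrable.fintype_prod fun i => integrable_mul_conj (hφ _) (hφ _)

/-- By orthonormality an index tuple `p` contributes the determinant of the matrix with entries `1`
where `p i = p j` and `0` elsewhere. This is the identity for injective `p` and has two equal rows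
otherwise. Each `k`-subset of `F` then arises from `k!` injective tuples. -/
lemma HasKernelExpansion.integral_det_partialKernel (h : HasKernelExpansion m K φ η)
    (F : Finset ι) (k : ℕ) :
    ∫ x : Fin k → Λ, (Matrix.of fun i j => partialKernel φ η F (x i) (x j)).det
      ∂(Measure.pi fun _ => m) = ((k.factorial * elemSymm η F k : ℝ) : ℂ) := by
  classical
  simp_rw [det_partialKernel]
  have hint : ∀ (σ : Equiv.Perm (Fin k)) (p : Fin k → ι), Integrable (fun x : Fin k → Λ =>
      ((σ.sign : ℤ) : ℂ) * ((∏ i, (η (p i) : ℂ)) *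
          ∏ i, (φ (p (σ.symm i)) (x i) * conj (φ (p i) (x i))))) (Measure.pi fun _ => m) :=
    fun σ p => Integrable.const_mul (Integrable.const_mul
      (Integrable.fintype_prod fun i => integrable_mul_conj (h.memLp _) (h.memLp _)) _) _
  rw [integral_finsetSum _ fun σ _ => integrable_finsetSum _ fun p _ => hint σ p]
  simp_rw [integral_finsetSum _ fun p _ => hint _ p, integral_const_mul]
  rw [Finset.sum_comm, ← sum_injective_prod_eq_elemSymm, Finset.sum_filter]
  push_cast
  refine Finset.sum_congr rfl fun p _ => ?_
  have hG : ∀ i j, ∫ x, φ i x * conj (φ j x) ∂m = if i = j then 1 else 0 := by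
    intro i j
    split_ifs with hij
    · rw [hij, h.inner_self]
    · exact h.inner_ne i j hij
  have hdet : ∑ σ : Equiv.Perm (Fin k), ((σ.sign : ℤ) : ℂ) * ((∏ i, (η (p i) : ℂ)) *
      ∫ x : Fin k → Λ, ∏ i, (φ (p (σ.symm i)) (x i) * conj (φ (p i) (x i)))
        ∂(Measure.pi fun _ => m)) =
      (∏ i, (η (p i) : ℂ)) * (Matrix.of fun i j => if p i = p j then (1 : ℂ) else 0).det := by
    rw [Matrix.det_apply', Finset.mul_sum]
    refine Finset.sum_congr rfl fun σ _ => ?_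
    rw [integral_fintype_prod_eq_prod fun i x => φ (p (σ.symm i)) x * conj (φ (p i) x)]
    simp_rw [hG, Matrix.of_apply]
    rw [← Equiv.prod_comp σ fun i => if p (σ.symm i) = p i then (1 : ℂ) else 0]
    simp_rw [Equiv.symm_apply_apply, eq_comm (a := p _) (b := p (σ _))]
    ring
  rw [hdet]
  split_ifs with hp
  · have : (Matrix.of fun i j => if p i = p j then (1 : ℂ) else 0) = 1 := by
      ext i j
      simp [Matrix.one_apply, hp.eq_iff]
    rw [this, Matrix.det_one, mul_one]
    push_cast
    rfl
  · obtain ⟨i, j, hij, hne⟩ := by simpa [Function.Injective] using hp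
    rw [Matrix.det_zero_of_row_eq hne (by ext l; simp [hij]), mul_zero]
    simp

/-- This transports almost everywhere statements on pairs to two coordinates of a `k`-tuple. Only
null sets are preserved, since the other coordinates carry a total mass that may differ from `1`. -/
lemma quasiMeasurePreserving_eval_pair {k : ℕ} {i j : Fin k} (hij : i ≠ j) :
    Measure.QuasiMeasurePreserving (fun x : Fin k → Λ => (x i, x j)) (Measure.pi fun _ => m)
      (m.prod m) := by
  obtain _ | k := k
  · exact i.elim0
  obtain ⟨l, rfl⟩ := Fin.exists_succAbove_eq hij.symm
  have h1 := (measurePreserving_piFinSuccAbove (fun _ : Fin (k + 1) => m) i).quasiMeasurePreserving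
  have h2 : Measure.QuasiMeasurePreserving (Prod.map id (Function.eval l))
      (m.prod (Measure.pi fun _ : Fin k => m)) (m.prod m) :=
    MeasureTheory.QuasiMeasurePreserving.prodMap (Measure.QuasiMeasurePreserving.id m)
      (Measure.quasiMeasurePreserving_eval (fun _ : Fin k => m) l)
  exact h2.comp h1

/-- Almost everywhere bounds and limits of the entries give the limits of the integrals. -/
theorem HasKernelExpansion.integrable_det_and_tendsto [Countable ι]
    (h : HasKernelExpansion m K φ η) (k : ℕ) :
    Integrable (fun x : Fin k → Λ => (Matrix.of fun i j => K (x i) (x j)).det)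
      (Measure.pi fun _ => m) ∧
    Tendsto (fun F => ((k.factorial * elemSymm η F k : ℝ) : ℂ)) atTop
      (𝓝 (∫ x : Fin k → Λ, (Matrix.of fun i j => K (x i) (x j)).det
        ∂(Measure.pi fun _ => m))) := by
  set g : Λ → ℝ := fun x => ∑' j, η j * ‖φ j x‖ ^ 2 with hg
  have hentry : ∀ᵐ x ∂(Measure.pi fun _ : Fin k => m), ∀ i j,
      HasSum (fun l => (η l : ℂ) * (φ l (x i) * conj (φ l (x j)))) (K (x i) (x j)) := by
    rw [ae_all_iff]; intro i
    rw [ae_all_iff]; intro j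
    -- Diagonal entries need their own hypothesis, as the diagonal can be a null set for `m.prod m`.
    rcases eq_or_ne i j with rfl | hij
    · exact (Measure.quasiMeasurePreserving_eval (fun _ : Fin k => m) i).ae h.diag
    · exact (quasiMeasurePreserving_eval_pair hij).ae h.offDiag
  have hdiag : ∀ x, Summable (fun l => (η l : ℂ) * (φ l x * conj (φ l x))) →
      Summable fun l => η l * ‖φ l x‖ ^ 2 := by
    intro x hx
    have := Complex.hasSum_re hx.hasSum
    refine this.summable.congr fun l => ?_
    rw [Complex.mul_conj, ← Complex.ofReal_mul, Complex.ofReal_re, Complex.normSq_eq_norm_sq]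
  -- Cauchy–Schwarz, with `η l` shared as `√(η l)` between the two factors.
  have hpartial : ∀ x y, Summable (fun l => η l * ‖φ l x‖ ^ 2) →
      Summable (fun l => η l * ‖φ l y‖ ^ 2) → ∀ F,
      ‖partialKernel φ η F x y‖ ≤ √(g x) * √(g y) := by
    intro x y hx hy F
    calc ‖partialKernel φ η F x y‖ ≤ ∑ l ∈ F, (√(η l) * ‖φ l x‖) * (√(η l) * ‖φ l y‖) := by
          refine (norm_sum_le _ _).trans_eq (Finset.sum_congr rfl fun l _ => ?_)
          rw [norm_mul, norm_mul, Complex.norm_real, RCLike.norm_conj,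
            Real.norm_of_nonneg (h.nonneg l)]
          nth_rewrite 1 [← Real.mul_self_sqrt (h.nonneg l)]
          ring
      _ ≤ √(∑ l ∈ F, (√(η l) * ‖φ l x‖) ^ 2) * √(∑ l ∈ F, (√(η l) * ‖φ l y‖) ^ 2) :=
          Real.sum_mul_le_sqrt_mul_sqrt _ _ _
      _ ≤ √(g x) * √(g y) := by
          simp_rw [mul_pow, Real.sq_sqrt (h.nonneg _)]
          have hnn : ∀ z l, 0 ≤ η l * ‖φ l z‖ ^ 2 := fun z l =>
            mul_nonneg (h.nonneg l) (sq_nonneg _)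
          gcongr
          · exact hx.sum_le_tsum F fun l _ => hnn x l
          · exact hy.sum_le_tsum F fun l _ => hnn y l
  have hgint : Integrable g m := by
    have hi : ∀ j, Integrable (fun x => η j * ‖φ j x‖ ^ 2) m := fun j =>
      (h.memLp j).integrable_norm_pow two_ne_zero |>.const_mul _
    have hone : ∀ j, ∫ x, ‖φ j x‖ ^ 2 ∂m = 1 := by
      intro j
      have h1 := h.inner_self j
      simp_rw [Complex.mul_conj, Complex.normSq_eq_norm_sq] at h1
      rw [integral_complex_ofReal] at h1
      exact_mod_cast h1
    refine (integrable_tsum_of_nonneg hi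
      (fun j x => mul_nonneg (h.nonneg j) (sq_nonneg _)) ?_).2
    simpa only [integral_const_mul, hone, mul_one] using h.summable
  have hbound : ∀ F, ∀ᵐ x ∂(Measure.pi fun _ : Fin k => m),
      ‖(Matrix.of fun i j => partialKernel φ η F (x i) (x j)).det‖ ≤
        k.factorial * ∏ i, g (x i) := by
    intro F
    filter_upwards [hentry] with x hx
    have hgx : ∀ i, Summable fun l => η l * ‖φ l (x i)‖ ^ 2 := fun i =>
      hdiag _ (hx i i).summable
    have hg0 : ∀ i, 0 ≤ g (x i) := fun i =>
      tsum_nonneg fun l => mul_nonneg (h.nonneg l) (sq_nonneg _)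
    rw [Matrix.det_apply']
    refine (norm_sum_le _ _).trans ?_
    have : ∀ σ : Equiv.Perm (Fin k), ‖((σ.sign : ℤ) : ℂ) *
        ∏ i, (Matrix.of fun i j => partialKernel φ η F (x i) (x j)) (σ i) i‖ ≤ ∏ i, g (x i) := by
      intro σ
      have hs : ‖((σ.sign : ℤ) : ℂ)‖ = 1 := by
        rcases Int.units_eq_one_or σ.sign with h | h <;> simp [h]
      rw [norm_mul, hs, one_mul, norm_prod]
      -- In every permutation term each coordinate occurs twice, so the square roots combine to `∏ g
      -- (x i)`. This majorant is integrable and independent of `F`.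
      calc _ ≤ ∏ i, (√(g (x (σ i))) * √(g (x i))) :=
            Finset.prod_le_prod (fun _ _ => norm_nonneg _)
              fun i _ => hpartial _ _ (hgx _) (hgx _) F
        _ = ∏ i, g (x i) := by
            rw [Finset.prod_mul_distrib, Equiv.prod_comp σ fun i => √(g (x i)),
              ← Finset.prod_mul_distrib]
            exact Finset.prod_congr rfl fun i _ => Real.mul_self_sqrt (hg0 i)
    refine (Finset.sum_le_sum fun σ _ => this σ).trans_eq ?_
    rw [Finset.sum_const, Finset.card_univ, Fintype.card_perm, Fintype.card_fin, nsmul_eq_mul]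
  have hlim : ∀ᵐ x ∂(Measure.pi fun _ : Fin k => m), Tendsto
      (fun F => (Matrix.of fun i j => partialKernel φ η F (x i) (x j)).det) atTop
      (𝓝 (Matrix.of fun i j => K (x i) (x j)).det) := by
    filter_upwards [hentry] with x hx
    have h1 : Tendsto (fun F => Matrix.of fun i j => partialKernel φ η F (x i) (x j)) atTop
        (𝓝 (Matrix.of fun i j => K (x i) (x j))) :=
      tendsto_pi_nhds.2 fun i => tendsto_pi_nhds.2 fun j => hx i j
    exact ((continuous_id.matrix_det).tendsto _).comp h1
  have hgprod : Integrable (fun x : Fin k → Λ => k.factorial * ∏ i, g (x i))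
      (Measure.pi fun _ => m) :=
    (Integrable.fintype_prod fun _ => hgint).const_mul _
  have hmeasF : ∀ F, AEStronglyMeasurable (fun x : Fin k → Λ =>
      (Matrix.of fun i j => partialKernel φ η F (x i) (x j)).det) (Measure.pi fun _ => m) :=
    fun F => (integrable_det_partialKernel h.memLp F k).aestronglyMeasurable
  refine ⟨?_, ?_⟩
  · refine Integrable.mono' hgprod (aestronglyMeasurable_of_tendsto_ae atTop hmeasF hlim) ?_
    filter_upwards [hlim, (ae_all_iff.2 hbound : ∀ᵐ x ∂_, ∀ F, _)] with x h1 h2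
    exact le_of_tendsto' h1.norm h2
  · simp_rw [← h.integral_det_partialKernel]
    exact tendsto_integral_filter_of_dominated_convergence _ (Eventually.of_forall hmeasF)
      (Eventually.of_forall hbound) hgprod hlim

end DeterminantIntegrals

/-! ### Counting variables of determinantal processes -/

lemma IsDeterminantal.measurable_apply {Λ Ω : Type*} [TopologicalSpace Λ] [MeasurableSpace Λ]
    [MeasurableSpace Ω] {P : Measure Ω} {χ : Ω → Measure Λ} {μ : Measure Λ} {K : Λ → Λ → ℂ}
    (hχ : IsDeterminantal P χ μ K) {D : Set Λ} (hD : MeasurableSet D) :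
    Measurable fun ω => χ ω D :=
  (Measure.measurable_coe hD).comp hχ.isSimplePointProcess.measurable

section DeterminantalCounts

variable {Λ Ω ι : Type*} [MeasurableSpace Λ] [MeasurableSpace Ω] {μ : Measure Λ}
  {K : Λ → Λ → ℂ} {D : Set Λ} {φ : ι → Λ → ℂ} {η : ι → ℝ} [Countable ι]

/-- At a tuple with a repeated point the determinant has two equal rows and vanishes, so the tuples
with coincidences contribute nothing, even if `μ` has atoms. -/
lemma setLIntegral_injective_intensity (hD : MeasurableSet D)
    [MeasurableSpace.CountablyGenerated Λ] [MeasurableSpace.SeparatesPoints Λ] {k : ℕ}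
    {ρ : (Fin k → Λ) → ℝ}
    (hρ : ∀ᵐ x ∂(Measure.pi fun _ : Fin k => μ),
      (ρ x : ℂ) = (Matrix.of fun i j => K (x i) (x j)).det) :
    ∫⁻ x in {x | (∀ i, x i ∈ D) ∧ Function.Injective x}, ENNReal.ofReal (ρ x)
        ∂(Measure.pi fun _ => μ) =
      ∫⁻ x in Set.univ.pi fun _ => D, ENNReal.ofReal (ρ x) ∂(Measure.pi fun _ => μ) := by
  have hAm : MeasurableSet {x : Fin k → Λ | (∀ i, x i ∈ D) ∧ Function.Injective x} := by
    rw [← iUnion_separatedTuples]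
    exact MeasurableSet.iUnion fun n => measurableSet_separatedTuples hD k n
  rw [← lintegral_indicator hAm, ← lintegral_indicator (MeasurableSet.univ_pi fun _ => hD)]
  refine lintegral_congr_ae ?_
  filter_upwards [hρ] with x hx
  by_cases hxD : ∀ i, x i ∈ D
  · rw [Set.indicator_of_mem (s := Set.univ.pi fun _ => D) (by simpa using hxD)]
    by_cases hinj : Function.Injective x
    · rw [Set.indicator_of_mem (by exact ⟨hxD, hinj⟩)]
    · rw [Set.indicator_of_notMem (fun h => hinj h.2)]
      obtain ⟨i, j, hij, hne⟩ := by simpa [Function.Injective] using hinj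
      rw [Matrix.det_zero_of_row_eq hne (by ext l; simp [hij])] at hx
      simp [Complex.ofReal_eq_zero.1 hx]
  · rw [Set.indicator_of_notMem (fun h => hxD h.1),
      Set.indicator_of_notMem (fun h => hxD (by simpa using h))]

variable [SigmaFinite μ]

lemma HasKernelExpansion.lintegral_intensity
    (h : HasKernelExpansion (μ.restrict D) K φ η) {k : ℕ}
    {ρ : (Fin k → Λ) → ℝ} (hρ0 : ∀ x, 0 ≤ ρ x)
    (hρ : ∀ᵐ x ∂(Measure.pi fun _ : Fin k => μ),
      (ρ x : ℂ) = (Matrix.of fun i j => K (x i) (x j)).det) :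
    ∫⁻ x in Set.univ.pi fun _ => D, ENNReal.ofReal (ρ x) ∂(Measure.pi fun _ => μ) =
      ENNReal.ofReal (∫ x : Fin k → Λ, (Matrix.of fun i j => K (x i) (x j)).det
        ∂(Measure.pi fun _ => μ.restrict D)).re := by
  have hres := Measure.restrict_pi_pi (fun _ : Fin k => μ) fun _ => D
  have hint := (h.integrable_det_and_tendsto k).1
  rw [← hres] at hint ⊢
  have hρ' := ae_restrict_of_ae (s := Set.univ.pi fun _ => D) hρ
  have hre : ∀ᵐ x ∂((Measure.pi fun _ : Fin k => μ).restrict (Set.univ.pi fun _ => D)),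
      RCLike.re (Matrix.of fun i j => K (x i) (x j)).det = ρ x := by
    filter_upwards [hρ'] with x hx
    rw [← hx]; simp
  have hρint := hint.re.congr hre
  rw [← ofReal_integral_eq_lintegral_ofReal hρint (Eventually.of_forall hρ0),
    ← integral_congr_ae hre, integral_re hint]
  rfl

variable [TopologicalSpace Λ] {P : Measure Ω} {χ : Ω → Measure Λ}

/-- For `k = 1` disjointness is vacuous and the expected count is the integral of `K x x` over `D`,
which the kernel expansion makes finite. -/
lemma IsDeterminantal.ae_lt_top (hχ : IsDeterminantal P χ μ K) (hD : MeasurableSet D)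
    (h : HasKernelExpansion (μ.restrict D) K φ η) : ∀ᵐ ω ∂P, χ ω D < ∞ := by
  obtain ⟨ρ, hρ, hρK⟩ := hχ.jointIntensity 1 le_rfl
  have h1 := hρ.lintegral_eq (fun _ => D) (fun _ => hD)
    fun i j hij => (hij (Subsingleton.elim i j)).elim
  rw [h.lintegral_intensity hρ.nonneg hρK] at h1
  simp only [Finset.univ_unique, Finset.prod_singleton] at h1
  refine MeasureTheory.ae_lt_top (hχ.measurable_apply hD) ?_
  exact h1.trans_ne ENNReal.ofReal_ne_top

variable [IsProbabilityMeasure P]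

/-- The number of points in `D` has the factorial moments, and hence the Laplace transform, of a
sum of independent Bernoulli variables. -/
theorem IsDeterminantal.hasBernoulliMGF_countIn
    [MeasurableSpace.CountablyGenerated Λ] [MeasurableSpace.SeparatesPoints Λ]
    (hχ : IsDeterminantal P χ μ K) (hD : MeasurableSet D)
    (h : HasKernelExpansion (μ.restrict D) K φ η) (hη : ∀ j, η j ≤ 1) :
    HasBernoulliMGF (countIn χ D) P η ∧ MemLp (countIn χ D) 2 P ∧
      ∫ ω, countIn χ D ω ∂P = ∑' j, η j ∧
      variance (countIn χ D) P = ∑' j, η j * (1 - η j) := by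
  -- The floor gives a natural-valued measurable version of the count, defined also on the null set
  -- where the count is infinite or not an integer.
  set M : Ω → ℕ := fun ω => ⌊(χ ω D).toReal⌋₊ with hMdef
  have hM : Measurable M :=
    Nat.measurable_floor.comp (hχ.measurable_apply hD).ennreal_toReal
  have hMχ : ∀ᵐ ω ∂P, χ ω D = M ω := by
    filter_upwards [hχ.ae_lt_top hD h, hχ.isSimplePointProcess.integerValued] with ω h1 h2
    obtain ⟨m, hm⟩ := h2 D hD
    induction m with
    | top => simp [hm] at h1
    | coe m => simp [hMdef, hm]
  have hcount : (fun ω => (M ω : ℝ)) =ᵐ[P] countIn χ D := by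
    filter_upwards [hMχ] with ω hω
    simp [countIn, hω]
  set E : ℕ → ℝ := fun k => (∫ x : Fin k → Λ, (Matrix.of fun i j => K (x i) (x j)).det
    ∂(Measure.pi fun _ => μ.restrict D)).re / k.factorial with hE
  have hElim : ∀ k, Tendsto (fun F => elemSymm η F k) atTop (𝓝 (E k)) := by
    intro k
    have h1 := (Complex.continuous_re.tendsto _).comp (h.integrable_det_and_tendsto k).2
    refine (h1.div_const (k.factorial : ℝ)).congr fun F => ?_
    rw [Function.comp_apply, Complex.ofReal_re, mul_div_cancel_left₀]
    exact_mod_cast k.factorial_ne_zero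
  have hdesc : ∀ k, ∫⁻ ω, ((M ω).descFactorial k : ℝ≥0∞) ∂P =
      ENNReal.ofReal (k.factorial * E k) := by
    intro k
    have hk : (k.factorial : ℝ) * E k = (∫ x : Fin k → Λ, (Matrix.of fun i j =>
        K (x i) (x j)).det ∂(Measure.pi fun _ => μ.restrict D)).re := by
      rw [hE]
      exact mul_div_cancel₀ _ (by exact_mod_cast k.factorial_ne_zero)
    rw [hk]
    -- Joint intensities start at order `1`; for `k = 0` both sides equal `1`.
    rcases Nat.eq_zero_or_pos k with rfl | hk0
    · simp
    · obtain ⟨ρ, hρ, hρK⟩ := hχ.jointIntensity k hk0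
      rw [hχ.isSimplePointProcess.lintegral_descFactorial hρ hD hMχ,
        setLIntegral_injective_intensity hD hρK, h.lintegral_intensity hρ.nonneg hρK]
  have hchoose : ∀ k, ∫⁻ ω, ((M ω).choose k : ℝ≥0∞) ∂P = ENNReal.ofReal (E k) := by
    intro k
    have h1 := hdesc k
    simp_rw [Nat.descFactorial_eq_factorial_mul_choose] at h1
    push_cast at h1
    have hm : Measurable fun ω => ((M ω).choose k : ℝ≥0∞) :=
      (measurable_from_nat (f := fun m => (m.choose k : ℝ≥0∞))).comp hM
    rw [lintegral_const_mul _ hm, ENNReal.ofReal_mul (by positivity),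
      ENNReal.ofReal_natCast] at h1
    exact (ENNReal.mul_right_inj (by exact_mod_cast k.factorial_ne_zero)
      (ENNReal.natCast_ne_top _)).1 h1
  have hη' : ∀ j, η j ∈ Set.Icc (0 : ℝ) 1 := fun j => ⟨h.nonneg j, hη j⟩
  have h1 := hasBernoulliMGF_of_choose hM hη' h.summable hElim hchoose
  obtain ⟨h2, h3, h4⟩ := memLp_two_and_variance_of_choose hM hη' h.summable hElim hchoose
  refine ⟨⟨hη', h.summable, fun s => ?_, fun s => ?_⟩, h2.ae_eq hcount, ?_, ?_⟩
  · exact (h1.integrable_exp s).congr (hcount.mono fun ω hω => by simp only [hω])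
  · rw [← mgf_congr hcount]
    exact h1.tendsto_prod s
  · rw [← integral_congr_ae hcount, h3]
  · rw [← variance_congr hcount, h4]

end DeterminantalCounts

/-! ### Positive trace class operators -/

section TraceClass

variable {H : Type*} [NormedAddCommGroup H] [InnerProductSpace ℂ H] {ι : Type*}

/-- `T f = ∑ⱼ ηⱼ ⟨φⱼ, f⟩ φⱼ` for an orthonormal family `φ`, where all `ηⱼ` are positive. -/
structure IsSpectralExpansion (T : H →L[ℂ] H) (φ : ι → H) (η : ι → ℝ) : Prop where
  orthonormal : Orthonormal ℂ φ
  pos : ∀ j, 0 < η j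
  apply_eq : ∀ j, T (φ j) = (η j : ℂ) • φ j
  hasSum : ∀ f, HasSum (fun j => ((η j : ℂ) * ⟪φ j, f⟫_ℂ) • φ j) (T f)

lemma IsSpectralExpansion.hasSum_inner {T : H →L[ℂ] H} {φ : ι → H} {η : ι → ℝ}
    (h : IsSpectralExpansion T φ η) (f g : H) :
    HasSum (fun j => (η j : ℂ) * ⟪φ j, g⟫_ℂ * ⟪f, φ j⟫_ℂ) ⟪f, T g⟫_ℂ := by
  have := (innerSL ℂ f).hasSum (h.hasSum g)
  simpa [inner_smul_right] using this

lemma HilbertBasis.hasSum_norm_inner_sq {κ : Type*} (b : HilbertBasis κ ℂ H) (x : H) :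
    HasSum (fun i => ‖⟪x, b i⟫_ℂ‖ ^ 2) (‖x‖ ^ 2) := by
  have h1 := Complex.hasSum_re (b.hasSum_inner_mul_inner x x)
  have h2 : (⟪x, x⟫_ℂ).re = ‖x‖ ^ 2 := inner_self_eq_norm_sq (𝕜 := ℂ) x
  rw [h2] at h1
  refine h1.congr_fun fun i => ?_
  rw [← inner_conj_symm (b i) x, Complex.mul_conj, Complex.ofReal_re, Complex.normSq_eq_norm_sq]

lemma IsSpectralExpansion.re_inner {T : H →L[ℂ] H} {φ : ι → H} {η : ι → ℝ}
    (h : IsSpectralExpansion T φ η) (f : H) :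
    HasSum (fun j => η j * ‖⟪φ j, f⟫_ℂ‖ ^ 2) (⟪f, T f⟫_ℂ).re := by
  have h1 := Complex.hasSum_re (h.hasSum_inner f f)
  refine h1.congr_fun fun j => ?_
  rw [mul_assoc, ← inner_conj_symm f (φ j), Complex.mul_conj, ← Complex.ofReal_mul,
    Complex.ofReal_re, Complex.normSq_eq_norm_sq]

/-- The trace of `A* T A` for an operator `T` with a spectral expansion. -/
lemma IsSpectralExpansion.tsum_inner_comp {T : H →L[ℂ] H} {φ : ι → H} {η : ι → ℝ}
    (h : IsSpectralExpansion T φ η) {κ : Type*} (b : HilbertBasis κ ℂ H) {A A' : H → H}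
    (hA : ∀ x y, ⟪A' x, y⟫_ℂ = ⟪x, A y⟫_ℂ) :
    ∑' i, ENNReal.ofReal (⟪A (b i), T (A (b i))⟫_ℂ).re =
      ∑' j, ENNReal.ofReal (η j * ‖A' (φ j)‖ ^ 2) := by
  have hη := fun j => (h.pos j).le
  have h1 : ∀ i, ENNReal.ofReal (⟪A (b i), T (A (b i))⟫_ℂ).re =
      ∑' j, ENNReal.ofReal (η j * ‖⟪A' (φ j), b i⟫_ℂ‖ ^ 2) := by
    intro i
    have h2 := h.re_inner (A (b i))
    simp_rw [← hA] at h2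
    rw [← h2.tsum_eq, ENNReal.ofReal_tsum_of_nonneg
      (fun j => mul_nonneg (hη j) (sq_nonneg _)) h2.summable]
  have h3 : ∀ j, ENNReal.ofReal (η j * ‖A' (φ j)‖ ^ 2) =
      ∑' i, ENNReal.ofReal (η j * ‖⟪A' (φ j), b i⟫_ℂ‖ ^ 2) := by
    intro j
    have h2 := (HilbertBasis.hasSum_norm_inner_sq b (A' (φ j))).mul_left (η j)
    rw [← h2.tsum_eq, ENNReal.ofReal_tsum_of_nonneg
      (fun i => mul_nonneg (hη j) (sq_nonneg _)) h2.summable]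
  simp_rw [h1, h3]
  exact ENNReal.tsum_comm

lemma isCompactOperator_innerSL_smulRight (u v : H) :
    IsCompactOperator ((innerSL ℂ u).smulRight v : H →L[ℂ] H) := by
  have h1 : IsCompactOperator (innerSL ℂ u : H →L[ℂ] ℂ) :=
    isCompactOperator_of_locallyCompactSpace_dom (innerSL ℂ u)
  exact h1.clm_comp ((1 : ℂ →L[ℂ] ℂ).smulRight v)

variable [CompleteSpace H]

/-- Hilbert-Schmidt operators are compact. -/
lemma isCompactOperator_of_summable_norm_sq (b : HilbertBasis ι ℂ H) (S : H →L[ℂ] H)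
    (hS : Summable fun i => ‖S (b i)‖ ^ 2) : IsCompactOperator S := by
  classical
  set A : Finset ι → H →L[ℂ] H := fun F => ∑ i ∈ F, (innerSL ℂ (b i)).smulRight (S (b i)) with hA
  have hAapp : ∀ F x, A F x = ∑ i ∈ F, ⟪b i, x⟫_ℂ • S (b i) := by
    intro F x
    simp [hA]
  have hcompact : ∀ F, IsCompactOperator (A F) := fun F =>
    Submodule.sum_mem (compactOperator (RingHom.id ℂ) H H)
      fun i _ => isCompactOperator_innerSL_smulRight (b i) (S (b i))
  -- The tail of `S x = ∑ ⟪b i, x⟫ S (b i)` is bounded by Cauchy–Schwarz and Bessel's inequality, so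
  -- the finite rank truncations converge to `S` in norm.
  have hbound : ∀ F, ‖A F - S‖ ≤ √(∑' i, ‖S (b i)‖ ^ 2 - ∑ i ∈ F, ‖S (b i)‖ ^ 2) := by
    intro F
    refine ContinuousLinearMap.opNorm_le_bound _ (Real.sqrt_nonneg _) fun x => ?_
    have hx : HasSum (fun i => ⟪b i, x⟫_ℂ • S (b i)) (S x) := by
      have := S.hasSum (b.hasSum_repr x)
      simpa [b.repr_apply_apply] using this
    have hlim : Tendsto (fun G : Finset ι => A F x - ∑ i ∈ G, ⟪b i, x⟫_ℂ • S (b i)) atTop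
        (𝓝 ((A F - S) x)) := hx.const_sub _
    refine le_of_tendsto hlim.norm ?_
    filter_upwards [eventually_ge_atTop F] with G hG
    rw [hAapp, ← Finset.sum_sdiff hG, sub_add_cancel_right, norm_neg]
    calc ‖∑ i ∈ G \ F, ⟪b i, x⟫_ℂ • S (b i)‖ ≤ ∑ i ∈ G \ F, ‖S (b i)‖ * ‖⟪b i, x⟫_ℂ‖ := by
          refine (norm_sum_le _ _).trans_eq (Finset.sum_congr rfl fun i _ => ?_)
          rw [norm_smul, mul_comm]
      _ ≤ √(∑ i ∈ G \ F, ‖S (b i)‖ ^ 2) * √(∑ i ∈ G \ F, ‖⟪b i, x⟫_ℂ‖ ^ 2) :=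
          Real.sum_mul_le_sqrt_mul_sqrt _ _ _
      _ ≤ _ := by
          gcongr
          · rw [le_sub_iff_add_le, Finset.sum_sdiff hG]
            exact hS.sum_le_tsum G fun i _ => sq_nonneg _
          · rw [Real.sqrt_le_iff]
            exact ⟨norm_nonneg _, b.orthonormal.sum_inner_products_le x⟩
  have htend : Tendsto A atTop (𝓝 S) := by
    rw [tendsto_iff_norm_sub_tendsto_zero]
    refine squeeze_zero (fun F => norm_nonneg _) hbound ?_
    have h1 : Tendsto (fun F : Finset ι => ∑' i, ‖S (b i)‖ ^ 2 - ∑ i ∈ F, ‖S (b i)‖ ^ 2) atTop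
        (𝓝 (∑' i, ‖S (b i)‖ ^ 2 - ∑' i, ‖S (b i)‖ ^ 2)) := hS.hasSum.const_sub _
    simpa using h1.sqrt
  exact isCompactOperator_of_tendsto htend (Eventually.of_forall hcompact)

lemma IsTraceClass.exists_summable {T : H →L[ℂ] H} (hT : 0 ≤ T) (htr : IsTraceClass T) :
    ∃ (s : Set H) (b : HilbertBasis s ℂ H), Summable fun i => (⟪b i, T (b i)⟫_ℂ).re := by
  obtain ⟨s, b, h⟩ := htr
  exact ⟨s, b, by rwa [CFC.abs_of_nonneg T hT] at h⟩

/-- The square root `S` of `T` satisfies `‖S (b i)‖² = ⟪b i, T (b i)⟫`, so it is Hilbert–Schmidt,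
hence compact, and so is `T = S * S`. -/
lemma IsTraceClass.isCompactOperator {T : H →L[ℂ] H} (hT : 0 ≤ T) (htr : IsTraceClass T) :
    IsCompactOperator T := by
  obtain ⟨s, b, h⟩ := htr.exists_summable hT
  set S : H →L[ℂ] H := CFC.sqrt T with hS
  have hSS : S * S = T := CFC.sqrt_mul_sqrt_self T hT
  have hSpos : S.IsPositive := (ContinuousLinearMap.nonneg_iff_isPositive S).1 (CFC.sqrt_nonneg T)
  have hcomp : IsCompactOperator S := by
    refine isCompactOperator_of_summable_norm_sq b S (h.congr fun i => ?_)
    rw [← hSS, mul_apply_eq_comp, ← hSpos.inner_left_eq_inner_right,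
      ← RCLike.re_eq_complex_re, inner_self_eq_norm_sq]
  rw [← hSS]
  exact hcomp.clm_comp S

lemma IsSpectralExpansion.summable {T : H →L[ℂ] H} {φ : ι → H} {η : ι → ℝ}
    (h : IsSpectralExpansion T φ η) (hT : 0 ≤ T) (htr : IsTraceClass T) : Summable η := by
  obtain ⟨s, b, hb⟩ := htr.exists_summable hT
  have h1 := h.tsum_inner_comp b (A := id) (A' := id) fun x y => rfl
  simp only [id, h.orthonormal.1, one_pow, mul_one] at h1
  have hpos := (ContinuousLinearMap.nonneg_iff_isPositive T).1 hT
  rw [← ENNReal.ofReal_tsum_of_nonneg (f := fun i => (⟪b i, T (b i)⟫_ℂ).re)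
    (fun i => hpos.re_inner_nonneg_right (b i)) hb] at h1
  refine (ENNReal.summable_toReal (h1 ▸ ENNReal.ofReal_ne_top)).congr fun j => ?_
  exact ENNReal.toReal_ofReal (h.pos j).le

/-- Spectral theorem for positive compact operators, with the eigenvalues repeated according to
multiplicity. -/
theorem exists_isSpectralExpansion {T : H →L[ℂ] H} (hT : 0 ≤ T) (hc : IsCompactOperator T) :
    ∃ (ι : Type) (φ : ι → H) (η : ι → ℝ), IsSpectralExpansion T φ η ∧
      (Summable (fun j => η j * (1 - η j)) → eigenvalueSum T = ∑' j, η j * (1 - η j)) := by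
  have hpos := (ContinuousLinearMap.nonneg_iff_isPositive T).1 hT
  have hsymm : (T : H →ₗ[ℂ] H).IsSymmetric := hpos.isSymmetric
  -- Only nonzero eigenvalues are used, since compactness makes their eigenspaces
  -- finite-dimensional; each contributes an orthonormal basis.
  set R := {r : ℝ // r ≠ 0}
  set E : R → Submodule ℂ H := fun r => Module.End.eigenspace (T : H →ₗ[ℂ] H) ((r : ℝ) : ℂ) with hE
  have hfin : ∀ r, FiniteDimensional ℂ (E r) := fun r =>
    ContinuousLinearMap.finite_dimensional_eigenspace hc _ (by exact_mod_cast r.2)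
  set e : ∀ r, OrthonormalBasis (Fin (Module.finrank ℂ (E r))) ℂ (E r) := fun r =>
    stdOrthonormalBasis ℂ (E r)
  set φ : (Σ r : R, Fin (Module.finrank ℂ (E r))) → H := fun j => (e j.1 j.2 : H) with hφ
  set η : (Σ r : R, Fin (Module.finrank ℂ (E r))) → ℝ := fun j => j.1 with hη
  have hTφ : ∀ j, T (φ j) = (η j : ℂ) • φ j := fun j =>
    Module.End.mem_eigenspace_iff.1 (e j.1 j.2).2
  have horth : Orthonormal ℂ φ := by
    have h1 : OrthogonalFamily ℂ (fun r : R => E r) fun r => (E r).subtypeₗᵢ :=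
      hsymm.orthogonalFamily_eigenspaces.comp (f := fun r : R => ((r : ℝ) : ℂ))
        fun r r' h => Subtype.ext (Complex.ofReal_injective h)
    exact h1.orthonormal_sigma_orthonormal fun r => (e r).orthonormal
  have hηpos : ∀ j, 0 < η j := by
    intro j
    refine lt_of_le_of_ne ?_ (Ne.symm j.1.2)
    have h1 := hpos.re_inner_nonneg_right (φ j)
    rw [hTφ, inner_smul_right, inner_self_eq_norm_sq_to_K, horth.1] at h1
    simpa using h1
  have hker : ∀ f, (∀ j, ⟪φ j, f⟫_ℂ = 0) → T f = 0 := by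
    intro f hf
    -- For an eigenvector `v` with eigenvalue `c`, `⟪v, T f⟫` is a multiple of `⟪v, f⟫`, which is
    -- zero if `c = 0` and by assumption on `f` otherwise. As the eigenspaces of a compact
    -- self-adjoint operator span a dense subspace, `T f = 0`.
    have h1 : T f ∈ (⨆ c, Module.End.eigenspace (T : H →ₗ[ℂ] H) c)ᗮ := by
      rw [← Submodule.iInf_orthogonal, Submodule.mem_iInf]
      intro c
      rw [Submodule.mem_orthogonal]
      intro v hv
      have hTv : T v = c • v := Module.End.mem_eigenspace_iff.1 hv
      rw [← hpos.inner_left_eq_inner_right, hTv, inner_smul_left]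
      rcases eq_or_ne v 0 with rfl | hv0
      · simp
      rcases eq_or_ne c 0 with rfl | hc0
      · simp
      have hreal : (starRingEnd ℂ) c = c := hsymm.conj_eigenvalue_eq_self
        (Module.End.hasEigenvalue_of_hasEigenvector ⟨hv, hv0⟩)
      obtain ⟨r, hr⟩ := Complex.conj_eq_iff_real.1 hreal
      have hr0 : r ≠ 0 := fun h => hc0 (by rw [hr, h, Complex.ofReal_zero])
      have hv' : v ∈ E ⟨r, hr0⟩ := by rw [hr] at hv; exact hv
      have h2 := congrArg (Subtype.val) ((e ⟨r, hr0⟩).sum_repr' ⟨v, hv'⟩)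
      simp only [Submodule.coe_sum, Submodule.coe_smul] at h2
      rw [← h2, sum_inner, Finset.sum_eq_zero, mul_zero]
      intro l _
      rw [inner_smul_left, hf ⟨⟨r, hr0⟩, l⟩, mul_zero]
    rwa [ContinuousLinearMap.orthogonalComplement_iSup_eigenspaces_eq_bot hc hsymm,
      Submodule.mem_bot] at h1
  refine ⟨_, φ, η, ⟨horth, hηpos, hTφ, fun f => ?_⟩, fun hs => ?_⟩
  · obtain ⟨w, b, hw, hb⟩ := horth.toSubtypeRange.exists_hilbertBasis_extension
    have h1 : HasSum (fun i => ⟪b i, f⟫_ℂ • T (b i)) (T f) := by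
      have := T.hasSum (b.hasSum_repr f)
      simpa [b.repr_apply_apply] using this
    have hinj : Function.Injective φ := horth.linearIndependent.injective
    set i : (Σ r : R, Fin (Module.finrank ℂ (E r))) → w := fun j => ⟨φ j, hw ⟨j, rfl⟩⟩ with hi
    have hi_inj : Function.Injective i := fun j j' h => hinj (congrArg Subtype.val h)
    rw [← hi_inj.hasSum_iff] at h1
    · refine h1.congr_fun fun j => ?_
      simp only [Function.comp_apply, hi, hb, hTφ, smul_smul, mul_comm]
    · intro x hx
      have : T (b x) = 0 := by
        refine hker _ fun j => ?_
        have h2 : φ j = b (i j) := by simp [hi, hb]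
        rw [h2]
        exact b.orthonormal.2 fun h => hx ⟨j, h⟩
      rw [this, smul_zero]
  -- Grouping by eigenvalue counts each `r` with its multiplicity. Leaving out `r = 0` is harmless
  -- because of the factor `r * (1 - r)`.
  · rw [hs.tsum_sigma' fun r => Summable.of_finite]
    simp only [hη, tsum_fintype, Finset.sum_const, Finset.card_univ, Fintype.card_fin, nsmul_eq_mul]
    rw [eigenvalueSum]
    symm
    refine tsum_subtype_eq_of_support_subset (s := {r : ℝ | r ≠ 0}) (f := fun r : ℝ =>
      (Module.finrank ℂ (Module.End.eigenspace (T : H →ₗ[ℂ] H) (r : ℂ)) : ℝ) * (r * (1 - r))) ?_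
    intro r hr h0
    simp [h0] at hr

end TraceClass

lemma le_one_of_spectrum_subset {H : Type*} [NormedAddCommGroup H] [InnerProductSpace ℂ H]
    [CompleteSpace H] {S : H →L[ℂ] H} (hS : IsSelfAdjoint S)
    (hspec : spectrum ℝ S ⊆ Set.Icc 0 1) : S ≤ 1 :=
  CFC.le_one (fun _ hx => (hspec hx).2) hS

/-! ### Restriction of square integrable functions to a set -/

section IndicatorLp

variable {Λ : Type*} [MeasurableSpace Λ] {μ : Measure Λ} {D : Set Λ}

/-- The product of a square integrable function and the indicator of a measurable set. -/
def indicatorLp (hD : MeasurableSet D) (f : Lp ℂ 2 μ) : Lp ℂ 2 μ :=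
  ((Lp.memLp f).indicator hD).toLp _

lemma coeFn_indicatorLp (hD : MeasurableSet D) (f : Lp ℂ 2 μ) :
    indicatorLp hD f =ᵐ[μ] D.indicator f :=
  MemLp.coeFn_toLp _

lemma inner_indicatorLp_left (hD : MeasurableSet D) (f g : Lp ℂ 2 μ) :
    ⟪indicatorLp hD f, g⟫_ℂ = ⟪f, indicatorLp hD g⟫_ℂ := by
  rw [L2.inner_def, L2.inner_def]
  refine integral_congr_ae ?_
  filter_upwards [coeFn_indicatorLp hD f, coeFn_indicatorLp hD g] with x hf hg
  rw [hf, hg]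
  by_cases hx : x ∈ D <;> simp [hx]

lemma indicatorLp_indicatorLp_of_subset {L : Set Λ} (hD : MeasurableSet D) (hL : MeasurableSet L)
    (h : L ⊆ D) (f : Lp ℂ 2 μ) : indicatorLp hD (indicatorLp hL f) = indicatorLp hL f := by
  refine Lp.ext ?_
  filter_upwards [coeFn_indicatorLp hD (indicatorLp hL f), coeFn_indicatorLp hL f] with x h1 h2
  rw [h1, Set.indicator, h2]
  by_cases hx : x ∈ L
  · simp [hx, h hx]
  · simp [hx]

lemma norm_indicatorLp_le (hD : MeasurableSet D) (f : Lp ℂ 2 μ) : ‖indicatorLp hD f‖ ≤ ‖f‖ := by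
  refine Lp.norm_le_norm_of_ae_le ?_
  filter_upwards [coeFn_indicatorLp hD f] with x hx
  rw [hx]
  exact norm_indicator_le_norm_self _ _

lemma norm_sq_eq_integral (f : Lp ℂ 2 μ) : ‖f‖ ^ 2 = ∫ x, ‖f x‖ ^ 2 ∂μ := by
  have h : ((‖f‖ ^ 2 : ℝ) : ℂ) = ∫ x, ((‖f x‖ ^ 2 : ℝ) : ℂ) ∂μ := by
    have := inner_self_eq_norm_sq_to_K (𝕜 := ℂ) f
    rw [L2.inner_def] at this
    push_cast
    refine this.symm.trans (integral_congr_ae (Eventually.of_forall fun x => ?_))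
    simp only
    rw [inner_self_eq_norm_sq_to_K]
    rfl
  rw [integral_complex_ofReal] at h
  exact_mod_cast h

lemma integrable_norm_sq (f : Lp ℂ 2 μ) : Integrable (fun x => ‖f x‖ ^ 2) μ :=
  (Lp.memLp f).integrable_norm_pow two_ne_zero

lemma norm_sq_indicatorLp (hD : MeasurableSet D) (f : Lp ℂ 2 μ) :
    ‖indicatorLp hD f‖ ^ 2 = ∫ x in D, ‖f x‖ ^ 2 ∂μ := by
  rw [norm_sq_eq_integral, ← integral_indicator hD]
  refine integral_congr_ae ?_
  filter_upwards [coeFn_indicatorLp hD f] with x hx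
  rw [hx]
  by_cases h : x ∈ D <;> simp [h]

lemma IsIntegralOperator.apply_eq_indicatorLp {K : Λ → Λ → ℂ} {S T : Lp ℂ 2 μ →L[ℂ] Lp ℂ 2 μ}
    (hS : IsIntegralOperator μ K S) (hT : IsIntegralOperator μ (restrictKernel K D) T)
    (hD : MeasurableSet D) (f : Lp ℂ 2 μ) : T f = indicatorLp hD (S (indicatorLp hD f)) := by
  refine Lp.ext ?_
  filter_upwards [hT f, hS (indicatorLp hD f), coeFn_indicatorLp hD (S (indicatorLp hD f))]
    with x h1 h2 h3
  have h4 : ∫ y, restrictKernel K D x y * f y ∂μ =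
      ∫ y, D.indicator 1 x * (K x y * indicatorLp hD f y) ∂μ := by
    refine integral_congr_ae ?_
    filter_upwards [coeFn_indicatorLp hD f] with y hy
    rw [hy, restrictKernel]
    by_cases h : y ∈ D <;> simp [h, mul_assoc]
  rw [h1.2, h4, integral_const_mul, ← h2.2, h3]
  by_cases h : x ∈ D <;> simp [h]

variable {K : Λ → Λ → ℂ} {S T : Lp ℂ 2 μ →L[ℂ] Lp ℂ 2 μ}

lemma IsIntegralOperator.inner_restrict (hS : IsIntegralOperator μ K S)
    (hT : IsIntegralOperator μ (restrictKernel K D) T) (hD : MeasurableSet D) (f g : Lp ℂ 2 μ) :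
    ⟪f, T g⟫_ℂ = ⟪indicatorLp hD f, S (indicatorLp hD g)⟫_ℂ := by
  rw [hS.apply_eq_indicatorLp hT hD, inner_indicatorLp_left]

variable [TopologicalSpace Λ]

lemma IsAdmissible.nonneg_restrict (hS : IsAdmissible μ K S)
    (hT : IsIntegralOperator μ (restrictKernel K D) T) (hD : MeasurableSet D) : 0 ≤ T := by
  have hsymm := hS.isSelfAdjoint.isSymmetric
  rw [ContinuousLinearMap.nonneg_iff_isPositive]
  refine ⟨fun f g => ?_, fun f => ?_⟩
  · have h1 := hS.isIntegralOperator.inner_restrict hT hD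
    change ⟪T f, g⟫_ℂ = ⟪f, T g⟫_ℂ
    rw [← inner_conj_symm, h1, h1, inner_conj_symm]
    exact hsymm _ _
  · rw [ContinuousLinearMap.reApplyInnerSelf_apply, ← inner_conj_symm,
      hS.isIntegralOperator.inner_restrict hT hD, RCLike.conj_re]
    exact hS.nonneg _

/-- With `g` the restriction of `f` to `D`, `r = ⟪f, T f⟫ = ⟪g, S g⟫ ≤ ‖g‖² ≤ 1`, since `S ≤ 1`. -/
lemma IsAdmissible.eigenvalue_le_one (hS : IsAdmissible μ K S)
    (hT : IsIntegralOperator μ (restrictKernel K D) T) (hD : MeasurableSet D)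
    (hspec : spectrum ℝ S ⊆ Set.Icc 0 1) {r : ℝ} {f : Lp ℂ 2 μ} (hf : ‖f‖ = 1)
    (hTf : T f = (r : ℂ) • f) : r ≤ 1 := by
  have hle : S ≤ 1 := le_one_of_spectrum_subset hS.isSelfAdjoint hspec
  have h1 : ⟪f, T f⟫_ℂ = r := by
    rw [hTf, inner_smul_right, inner_self_eq_norm_sq_to_K, hf]; simp
  have h2 := (ContinuousLinearMap.le_def S 1).1 hle
  have h3 := h2.re_inner_nonneg_right (indicatorLp hD f)
  rw [sub_apply, one_apply_eq_self, inner_sub_right,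
    ← hS.isIntegralOperator.inner_restrict hT hD, h1, map_sub, inner_self_eq_norm_sq] at h3
  have h4 := norm_indicatorLp_le hD f
  rw [hf] at h4
  have h5 : RCLike.re (r : ℂ) = r := Complex.ofReal_re r
  have h6 : ‖indicatorLp hD f‖ ^ 2 ≤ 1 := pow_le_one₀ (norm_nonneg _) h4
  linarith

end IndicatorLp

/-! ### Series of functions -/

section Series

lemma integrable_tsum {α ι : Type*} [MeasurableSpace α] [Countable ι] {m : Measure α}
    {f : ι → α → ℂ} (hf : ∀ j, Integrable (f j) m) (hs : Summable fun j => ∫ x, ‖f j x‖ ∂m) :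
    Integrable (fun x => ∑' j, f j x) m := by
  obtain ⟨h1, h2⟩ := integrable_tsum_of_nonneg (fun j => (hf j).norm)
    (fun j x => norm_nonneg _) hs
  refine h2.mono' ?_ ?_
  · refine aestronglyMeasurable_of_tendsto_ae (u := (atTop : Filter (Finset ι)))
      (f := fun F x => ∑ j ∈ F, f j x)
      (fun F => (integrable_finsetSum F fun j _ => hf j).aestronglyMeasurable) ?_
    filter_upwards [h1] with x hx using hx.of_norm.hasSum
  · filter_upwards [h1] with x hx using norm_tsum_le_tsum_norm hx

/-- A series that converges both in `L²` and pointwise has the same sum in both senses. -/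
lemma ae_eq_tsum_of_hasSum_Lp {α ι : Type*} [MeasurableSpace α] [Countable ι] {m : Measure α}
    {f : ι → Lp ℂ 2 m} {g : Lp ℂ 2 m} (h : HasSum f g)
    (hs : ∀ᵐ x ∂m, Summable fun j => f j x) : g =ᵐ[m] fun x => ∑' j, f j x := by
  obtain ⟨F, hF, hlim⟩ := (tendstoInMeasure_of_tendsto_Lp h).exists_seq_tendsto_ae'
  have hcoe : ∀ᵐ x ∂m, ∀ n, (∑ j ∈ F n, f j : Lp ℂ 2 m) x = ∑ j ∈ F n, f j x := by
    rw [ae_all_iff]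
    intro n
    filter_upwards [Lp.coeFn_finsetSum (F n) f] with x hx
    rw [hx, Finset.sum_apply]
  filter_upwards [hlim, hs, hcoe] with x h1 h2 h3
  refine tendsto_nhds_unique h1 ?_
  simp_rw [h3]
  exact h2.hasSum.comp hF

/-- Testing on a generating `π`-system suffices. With a countable one, the null sets of `x` arising
from the individual test sets have a null union when the sections of two kernels are compared. -/
lemma ae_eq_of_forall_setIntegral_eq_of_isPiSystem {α : Type*} [mα : MeasurableSpace α]
    {m : Measure α} {f g : α → ℂ} {C : Set (Set α)} (hgen : mα = MeasurableSpace.generateFrom C)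
    (hpi : IsPiSystem C) (hf : Integrable f m) (hg : Integrable g m)
    (huniv : ∫ x, f x ∂m = ∫ x, g x ∂m) (h : ∀ s ∈ C, ∫ x in s, f x ∂m = ∫ x in s, g x ∂m) :
    f =ᵐ[m] g := by
  have hall : ∀ s, MeasurableSet s → ∫ x in s, f x ∂m = ∫ x in s, g x ∂m := by
    intro s hs
    induction s, hs using MeasurableSpace.induction_on_inter hgen hpi with
    | empty => simp
    | basic t ht => exact h t ht
    | compl t ht ih =>
      have h1 := integral_add_compl ht hf
      have h2 := integral_add_compl ht hg
      rw [ih] at h1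
      exact add_left_cancel (h1.trans (huniv.trans h2.symm))
    | iUnion t hd ht ih =>
      rw [integral_iUnion ht hd hf.integrableOn, integral_iUnion ht hd hg.integrableOn]
      exact tsum_congr ih
  exact hf.ae_eq_of_forall_setIntegral_eq _ _ hg fun s hs _ => hall s hs

end Series

/-! ### A countable generating `π`-system -/

section CountablePiSystem

variable (Λ : Type*) [MeasurableSpace Λ] [MeasurableSpace.CountablyGenerated Λ]

/-- The finite intersections of a countable sequence of sets generating the `σ`-algebra. -/
def generatingInter (F : Finset ℕ) : Set Λ := ⋂ i ∈ F, MeasurableSpace.natGeneratingSequence Λ i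

lemma measurableSet_generatingInter (F : Finset ℕ) : MeasurableSet (generatingInter Λ F) :=
  F.measurableSet_biInter fun i _ => MeasurableSpace.measurableSet_natGeneratingSequence i

lemma isPiSystem_range_generatingInter : IsPiSystem (Set.range (generatingInter Λ)) := by
  classical
  rintro _ ⟨F, rfl⟩ _ ⟨G, rfl⟩ -
  exact ⟨F ∪ G, by ext x; simp only [generatingInter, Finset.mem_union, Set.mem_iInter, Set.mem_inter_iff, or_imp,
    forall_and]⟩

lemma generateFrom_range_generatingInter : ‹MeasurableSpace Λ› =
    MeasurableSpace.generateFrom (Set.range (generatingInter Λ)) := by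
  refine le_antisymm ?_ (MeasurableSpace.generateFrom_le ?_)
  · conv_lhs => rw [← MeasurableSpace.generateFrom_natGeneratingSequence Λ]
    refine MeasurableSpace.generateFrom_mono ?_
    rintro _ ⟨i, rfl⟩
    exact ⟨{i}, by simp [generatingInter]⟩
  · rintro _ ⟨F, rfl⟩
    exact measurableSet_generatingInter Λ F

end CountablePiSystem

/-! ### Eigenfunction expansions of kernels -/

section Expansion

open ComplexConjugate

variable {Λ ι : Type*} [MeasurableSpace Λ] {μ : Measure Λ} {K : Λ → Λ → ℂ}
  {T : Lp ℂ 2 μ →L[ℂ] Lp ℂ 2 μ} {φ : ι → Lp ℂ 2 μ} {η : ι → ℝ}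

lemma summable_mul_conj_of_summable_sq {a b : ι → ℂ} (hη : ∀ j, 0 ≤ η j)
    (ha : Summable fun j => η j * ‖a j‖ ^ 2) (hb : Summable fun j => η j * ‖b j‖ ^ 2) :
    Summable fun j => (η j : ℂ) * (a j * conj (b j)) := by
  refine Summable.of_norm_bounded (ha.add hb) fun j => ?_
  rw [norm_mul, norm_mul, Complex.norm_real, RCLike.norm_conj, Real.norm_of_nonneg (hη j),
    ← mul_add]
  have := hη j
  gcongr
  nlinarith [sq_nonneg (‖a j‖ - ‖b j‖), sq_nonneg ‖a j‖, sq_nonneg ‖b j‖]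

lemma Orthonormal.integral_norm_sq_eq_one (hφ : Orthonormal ℂ φ) (j : ι) :
    ∫ x, ‖φ j x‖ ^ 2 ∂μ = 1 := by
  rw [← norm_sq_eq_integral, hφ.1 j, one_pow]

variable [Countable ι]

lemma Orthonormal.ae_summable_and_integrable (hφ : Orthonormal ℂ φ) (hη : ∀ j, 0 ≤ η j)
    (hs : Summable η) : (∀ᵐ x ∂μ, Summable fun j => η j * ‖φ j x‖ ^ 2) ∧
      Integrable (fun x => ∑' j, η j * ‖φ j x‖ ^ 2) μ := by
  refine integrable_tsum_of_nonneg (fun j => (integrable_norm_sq (φ j)).const_mul _)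
    (fun j x => mul_nonneg (hη j) (sq_nonneg _)) ?_
  simpa only [integral_const_mul, hφ.integral_norm_sq_eq_one, mul_one] using hs

/-- On a set of finite measure `∫ |φ j| ≤ μ B + 1`, from `t ≤ 1 + t²`, and `η |a| ≤ η + η |a|²`.
Together these give the absolute convergence needed to exchange sum and integral. -/
lemma hasSum_setIntegral_mul_conj (hφ : Orthonormal ℂ φ) (hη : ∀ j, 0 ≤ η j) (hs : Summable η)
    {B : Set Λ} (hB : μ B ≠ ∞) {a : ι → ℂ} (ha : Summable fun j => η j * ‖a j‖ ^ 2) :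
    IntegrableOn (fun y => ∑' j, (η j : ℂ) * (a j * conj (φ j y))) B μ ∧
      HasSum (fun j => (η j : ℂ) * (a j * conj (∫ y in B, φ j y ∂μ)))
        (∫ y in B, ∑' j, (η j : ℂ) * (a j * conj (φ j y)) ∂μ) := by
  have : IsFiniteMeasure (μ.restrict B) := ⟨by simpa using hB.lt_top⟩
  have hint : ∀ j, Integrable (φ j) (μ.restrict B) := fun j =>
    ((Lp.memLp (φ j)).restrict B).integrable one_le_two
  have hconj : ∀ j, Integrable (fun y => conj (φ j y)) (μ.restrict B) := fun j =>
    (LinearIsometryEquiv.integrable_comp_iff Complex.conjLIE).2 (hint j)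
  have hI : ∀ j, Integrable (fun y => (η j : ℂ) * (a j * conj (φ j y))) (μ.restrict B) := fun j =>
    ((hconj j).const_mul _).const_mul _
  have hL1 : ∀ j, ∫ y in B, ‖φ j y‖ ∂μ ≤ μ.real B + 1 := by
    intro j
    calc ∫ y in B, ‖φ j y‖ ∂μ ≤ ∫ y in B, (1 + ‖φ j y‖ ^ 2) ∂μ := by
          refine integral_mono (hint j).norm
            ((integrable_const _).add (integrable_norm_sq (φ j)).integrableOn) fun y => ?_
          simp only
          nlinarith [sq_nonneg (‖φ j y‖ - 1), norm_nonneg (φ j y)]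
      _ = μ.real B + ∫ y in B, ‖φ j y‖ ^ 2 ∂μ := by
          rw [integral_add (integrable_const _) (integrable_norm_sq (φ j)).integrableOn]
          simp
      _ ≤ μ.real B + 1 := by
          gcongr
          rw [← hφ.integral_norm_sq_eq_one j]
          exact setIntegral_le_integral (integrable_norm_sq (φ j))
            (Eventually.of_forall fun y => sq_nonneg _)
  have hsum : Summable fun j => ∫ y in B, ‖(η j : ℂ) * (a j * conj (φ j y))‖ ∂μ := by
    refine Summable.of_nonneg_of_le (fun j => integral_nonneg fun y => norm_nonneg _)
      (fun j => ?_) ((hs.add ha).mul_right (μ.real B + 1))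
    simp_rw [norm_mul, RCLike.norm_conj, Complex.norm_real, Real.norm_of_nonneg (hη j)]
    rw [integral_const_mul, integral_const_mul, ← mul_assoc]
    have h1 : η j * ‖a j‖ ≤ η j + η j * ‖a j‖ ^ 2 := by
      nlinarith [mul_nonneg (hη j) (sq_nonneg (‖a j‖ - 1)), mul_nonneg (hη j) (norm_nonneg (a j))]
    have h2 : 0 ≤ ∫ y in B, ‖φ j y‖ ∂μ := integral_nonneg fun y => norm_nonneg _
    have h3 := mul_nonneg (hη j) (norm_nonneg (a j))
    calc _ ≤ η j * ‖a j‖ * (μ.real B + 1) := by gcongr; exact hL1 j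
      _ ≤ _ := by gcongr
  refine ⟨integrable_tsum hI hsum, ?_⟩
  have := hasSum_integral_of_summable_integral_norm hI hsum
  simpa only [integral_const_mul, integral_conj] using this

variable [SigmaFinite μ] [MeasurableSpace.CountablyGenerated Λ]

/-- The kernel of an operator with a spectral expansion, off the diagonal. -/
theorem IsSpectralExpansion.ae_prod_hasSum (h : IsSpectralExpansion T φ η) (hs : Summable η)
    (hK : Measurable (Function.uncurry K)) (hT : IsIntegralOperator μ K T) :
    ∀ᵐ p ∂(μ.prod μ), HasSum (fun j => (η j : ℂ) * (φ j p.1 * conj (φ j p.2))) (K p.1 p.2) := by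
  have hη := fun j => (h.pos j).le
  have hgood := (h.orthonormal.ae_summable_and_integrable hη hs).1
  set k : Λ → Λ → ℂ := fun x y => ∑' j, (η j : ℂ) * (φ j x * conj (φ j y)) with hk
  set B : ℕ × Finset ℕ → Set Λ := fun i => generatingInter Λ i.2 ∩ spanningSets μ i.1 with hB
  have hBm : ∀ i, MeasurableSet (B i) := fun i =>
    (measurableSet_generatingInter Λ i.2).inter (measurableSet_spanningSets μ i.1)
  have hBfin : ∀ i, μ (B i) ≠ ∞ := fun i =>
    ((measure_mono Set.inter_subset_right).trans_lt (measure_spanningSets_lt_top μ i.1)).ne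
  -- Applying `T` to the indicator of `B i` gives the integral of `K x` over `B i` on one hand and
  -- the integrated series on the other.
  have hsec : ∀ᵐ x ∂μ, ∀ i, IntegrableOn (K x) (B i) μ ∧ IntegrableOn (k x) (B i) μ ∧
      ∫ y in B i, K x y ∂μ = ∫ y in B i, k x y ∂μ := by
    rw [ae_all_iff]
    intro i
    set u : Lp ℂ 2 μ := indicatorConstLp 2 (hBm i) (hBfin i) (1 : ℂ) with hu
    have hinner : ∀ j, ⟪φ j, u⟫_ℂ = conj (∫ y in B i, φ j y ∂μ) := by
      intro j
      rw [← inner_conj_symm, L2.inner_indicatorConstLp_one]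
    have hKu : ∀ᵐ x ∂μ, IntegrableOn (K x) (B i) μ ∧ T u x = ∫ y in B i, K x y ∂μ := by
      filter_upwards [hT u] with x hx
      have h1 : (fun y => K x y * u y) =ᵐ[μ] (B i).indicator (K x) := by
        filter_upwards [indicatorConstLp_coeFn (p := 2) (hs := hBm i) (hμs := hBfin i) (c := (1 : ℂ))]
          with y hy
        rw [hu, hy]
        by_cases hyB : y ∈ B i <;> simp [hyB]
      rw [hx.2, integral_congr_ae h1, integral_indicator (hBm i),
        ← integrable_indicator_iff (hBm i)]
      exact ⟨hx.1.congr h1, rfl⟩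
    have hTu : T u =ᵐ[μ] fun x => ∑' j, (η j : ℂ) * (φ j x * conj (∫ y in B i, φ j y ∂μ)) := by
      have hcoe : ∀ᵐ x ∂μ, ∀ j, (((η j : ℂ) * ⟪φ j, u⟫_ℂ) • φ j : Lp ℂ 2 μ) x =
          (η j : ℂ) * (φ j x * conj (∫ y in B i, φ j y ∂μ)) := by
        rw [ae_all_iff]
        intro j
        filter_upwards [Lp.coeFn_smul ((η j : ℂ) * ⟪φ j, u⟫_ℂ) (φ j)] with x hx
        rw [hx, Pi.smul_apply, hinner, smul_eq_mul]
        ring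
      refine (ae_eq_tsum_of_hasSum_Lp (h.hasSum u) ?_).trans ?_
      · filter_upwards [hcoe, hgood] with x hx hx'
        simp_rw [hx]
        exact (hasSum_setIntegral_mul_conj h.orthonormal hη hs (hBfin i) hx').2.summable
      · filter_upwards [hcoe] with x hx
        simp_rw [hx]
    filter_upwards [hKu, hTu, hgood] with x h1 h2 h3
    have h4 := hasSum_setIntegral_mul_conj h.orthonormal hη hs (hBfin i) h3
    refine ⟨h1.1, h4.1, ?_⟩
    rw [← h1.2, h2, h4.2.tsum_eq]
  have hae : ∀ᵐ x ∂μ, ∀ᵐ y ∂μ, K x y = k x y := by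
    filter_upwards [hsec] with x hx
    rw [← Measure.restrict_univ (μ := μ), ← iUnion_spanningSets μ, ae_restrict_iUnion_iff]
    intro n
    have huniv : B (n, ∅) = spanningSets μ n := by simp [hB, generatingInter]
    have h0 := hx (n, ∅)
    rw [huniv] at h0
    refine ae_eq_of_forall_setIntegral_eq_of_isPiSystem (generateFrom_range_generatingInter Λ)
      (isPiSystem_range_generatingInter Λ) h0.1 h0.2.1 h0.2.2 ?_
    rintro _ ⟨F, rfl⟩
    rw [Measure.restrict_restrict (measurableSet_generatingInter Λ F)]
    exact (hx (n, F)).2.2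
  -- Passing from iterated null sets to a `μ.prod μ`-null set requires a measurable set of equality.
  -- The series is a pointwise limit of measurable functions once cut off to `G ×ˢ G`, where it
  -- converges, and `G` has full measure.
  set G : Set Λ := {x | ∑' j, ENNReal.ofReal (η j * ‖φ j x‖ ^ 2) < ∞} with hG
  have hφm : ∀ j, Measurable (φ j) := fun j => (Lp.stronglyMeasurable (φ j)).measurable
  have hGm : MeasurableSet G :=
    measurableSet_lt (Measurable.tsum fun j => by fun_prop) measurable_const
  have hGs : ∀ x, x ∈ G ↔ Summable fun j => η j * ‖φ j x‖ ^ 2 := by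
    intro x
    have hnn : ∀ j, 0 ≤ η j * ‖φ j x‖ ^ 2 := fun j => mul_nonneg (hη j) (sq_nonneg _)
    constructor
    · intro hx
      exact (ENNReal.summable_toReal (ne_of_lt hx)).congr fun j => ENNReal.toReal_ofReal (hnn j)
    · intro hx
      change ∑' j, ENNReal.ofReal (η j * ‖φ j x‖ ^ 2) < ∞
      rw [← ENNReal.ofReal_tsum_of_nonneg hnn hx]
      exact ENNReal.ofReal_lt_top
  have hkm : Measurable fun p : Λ × Λ => (G ×ˢ G).indicator (Function.uncurry k) p := by
    refine measurable_of_tendsto_metrizable' (atTop : Filter (Finset ι))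
      (f := fun F => (G ×ˢ G).indicator
        fun p : Λ × Λ => ∑ j ∈ F, (η j : ℂ) * (φ j p.1 * conj (φ j p.2)))
      (fun F => Measurable.indicator ?_ (hGm.prod hGm)) ?_
    · refine Finset.measurable_sum _ fun j _ => ?_
      exact (((hφm j).comp measurable_fst).mul
        (Complex.continuous_conj.measurable.comp ((hφm j).comp measurable_snd))).const_mul _
    · rw [tendsto_pi_nhds]
      intro p
      by_cases hp : p ∈ G ×ˢ G
      · simp_rw [Set.indicator_of_mem hp]
        exact (summable_mul_conj_of_summable_sq hη ((hGs _).1 hp.1) ((hGs _).1 hp.2)).hasSum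
      · simp_rw [Set.indicator_of_notMem hp]
        exact tendsto_const_nhds
  have hW : MeasurableSet {p : Λ × Λ |
      Function.uncurry K p = (G ×ˢ G).indicator (Function.uncurry k) p} :=
    measurableSet_eq_fun hK hkm
  have hGae : ∀ᵐ x ∂μ, x ∈ G := hgood.mono fun x hx => (hGs x).2 hx
  have hprod : ∀ᵐ p ∂(μ.prod μ), p ∈ {p : Λ × Λ |
      Function.uncurry K p = (G ×ˢ G).indicator (Function.uncurry k) p} := by
    rw [Measure.ae_prod_mem_iff_ae_ae_mem hW]
    filter_upwards [hae, hGae] with x hx hxG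
    filter_upwards [hx, hGae] with y hy hyG
    exact hy.trans (Set.indicator_of_mem (Set.mk_mem_prod hxG hyG) (Function.uncurry k)).symm
  filter_upwards [hprod, Measure.quasiMeasurePreserving_fst.ae hGae,
    Measure.quasiMeasurePreserving_snd.ae hGae] with p hp h1 h2
  rw [Set.indicator_of_mem (Set.mem_prod.2 ⟨h1, h2⟩)] at hp
  change K p.1 p.2 = k p.1 p.2 at hp
  rw [hp]
  exact (summable_mul_conj_of_summable_sq hη ((hGs _).1 h1) ((hGs _).1 h2)).hasSum

end Expansion

lemma measurable_restrictKernel {Λ : Type*} [MeasurableSpace Λ] {K : Λ → Λ → ℂ}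
    {D : Set Λ} (hK : Measurable (Function.uncurry K)) (hD : MeasurableSet D) :
    Measurable (Function.uncurry (restrictKernel K D)) := by
  have h1 : Measurable (D.indicator (1 : Λ → ℂ)) := measurable_one.indicator hD
  exact ((h1.comp measurable_fst).mul hK).mul (h1.comp measurable_snd)

/-! ### The kernel on the diagonal -/

section Diagonal

open scoped ComplexConjugate ComplexOrder

variable {Λ ι : Type*} [TopologicalSpace Λ] [MeasurableSpace Λ] [BorelSpace Λ] {μ : Measure Λ}
  {K : Λ → Λ → ℂ} {S T : Lp ℂ 2 μ →L[ℂ] Lp ℂ 2 μ} {D : Set Λ} {φ : ι → Lp ℂ 2 μ} {η : ι → ℝ}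

/-- Up to a null set, a measurable set is a countable union of compact sets. -/
lemma MeasurableSet.exists_iUnion_isCompact_ae_eq [T2Space Λ] [SigmaFinite μ]
    [μ.InnerRegularCompactLTTop] (hD : MeasurableSet D) :
    ∃ L : ℕ × ℕ → Set Λ, (∀ i, L i ⊆ D ∧ IsCompact (L i)) ∧ μ (D \ ⋃ i, L i) = 0 := by
  have h : ∀ i : ℕ × ℕ, ∃ L ⊆ D ∩ spanningSets μ i.1, IsCompact L ∧
      μ ((D ∩ spanningSets μ i.1) \ L) < ENNReal.ofReal (1 / (i.2 + 1)) := fun i =>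
    (hD.inter (measurableSet_spanningSets μ i.1)).exists_isCompact_sdiff_lt
      ((measure_mono Set.inter_subset_right).trans_lt (measure_spanningSets_lt_top μ i.1)).ne
      (by rw [Ne, ENNReal.ofReal_eq_zero, not_le]; positivity)
  choose L hLD hLc hL using h
  refine ⟨L, fun i => ⟨(hLD i).trans Set.inter_subset_left, hLc i⟩, ?_⟩
  have hsub : D \ ⋃ i, L i ⊆ ⋃ n, (D ∩ spanningSets μ n) \ ⋃ i, L i := by
    intro x hx
    have hxn : x ∈ ⋃ n, spanningSets μ n := by rw [iUnion_spanningSets]; trivial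
    obtain ⟨n, hn⟩ := Set.mem_iUnion.1 hxn
    exact Set.mem_iUnion.2 ⟨n, ⟨hx.1, hn⟩, hx.2⟩
  refine measure_mono_null hsub (measure_iUnion_null fun n => ?_)
  refine le_antisymm (ge_of_tendsto' (x := atTop) (f := fun k : ℕ =>
    ENNReal.ofReal (1 / ((k : ℝ) + 1))) ?_ fun k => ?_) zero_le
  · simpa using ENNReal.tendsto_ofReal (tendsto_one_div_add_atTop_nhds_zero_nat (𝕜 := ℝ))
  · refine le_trans (measure_mono ?_) (hL (n, k)).le
    exact Set.sdiff_subset_sdiff_right (Set.subset_iUnion L (n, k))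

variable [Countable ι]

/-- The trace of the compression to `L` is computed twice: it is the integral of `K x x` by the
normalisation of the kernel, and `∑ η j ‖1_L φ j‖²` by the expansion of `T`, because compressing `S`
or `T` to `L ⊆ D` gives the same operator. -/
lemma IsAdmissible.setIntegral_diag [T2Space Λ] (hS : IsAdmissible μ K S)
    (hT : IsIntegralOperator μ (restrictKernel K D) T) (hD : MeasurableSet D)
    (h : IsSpectralExpansion T φ η) (hs : Summable η) {L : Set Λ} (hL : IsCompact L)
    (hLD : L ⊆ D) : IntegrableOn (fun x => K x x) L μ ∧
      ∫ x in L, K x x ∂μ = ((∫ x in L, ∑' j, η j * ‖φ j x‖ ^ 2 ∂μ : ℝ) : ℂ) := by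
  have hη := fun j => (h.pos j).le
  have hLm := hL.measurableSet
  have hpos := (ContinuousLinearMap.nonneg_iff_isPositive T).1 (hS.nonneg_restrict hT hD)
  obtain ⟨TL, hTL, -, hint, htr⟩ := hS.locallyTraceClass L hL
  refine ⟨hint, ?_⟩
  obtain ⟨w, b, -⟩ := exists_hilbertBasis ℂ (Lp ℂ 2 μ)
  have hsum := htr w b
  have hTLT : ∀ f, ⟪f, TL f⟫_ℂ = ⟪indicatorLp hLm f, T (indicatorLp hLm f)⟫_ℂ := by
    intro f
    rw [hS.isIntegralOperator.inner_restrict hTL hLm, hS.isIntegralOperator.inner_restrict hT hD,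
      indicatorLp_indicatorLp_of_subset hD hLm hLD]
  simp_rw [hTLT] at hsum
  set t := ∫ x in L, K x x ∂μ with ht
  have hnn : ∀ f, 0 ≤ ⟪f, T f⟫_ℂ := fun f => hpos.inner_nonneg_right f
  have him : t.im = 0 := by
    have h1 := Complex.hasSum_im hsum
    have h2 : ∀ f, (⟪f, T f⟫_ℂ).im = 0 := fun f => (Complex.nonneg_iff.1 (hnn f)).2.symm
    simp only [h2] at h1
    exact h1.unique hasSum_zero
  have hre := Complex.hasSum_re hsum
  have hre0 : 0 ≤ t.re := hre.nonneg fun i => (Complex.nonneg_iff.1 (hnn _)).1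
  have htrace := h.tsum_inner_comp b (A := indicatorLp hLm) (A' := indicatorLp hLm)
    (inner_indicatorLp_left hLm)
  rw [← ENNReal.ofReal_tsum_of_nonneg (fun i => (Complex.nonneg_iff.1 (hnn _)).1) hre.summable,
    hre.tsum_eq] at htrace
  simp_rw [norm_sq_indicatorLp] at htrace
  have hI : ∀ j, Integrable (fun x => η j * ‖φ j x‖ ^ 2) (μ.restrict L) := fun j =>
    ((integrable_norm_sq (φ j)).const_mul _).integrableOn
  have hle : ∀ j, ∫ x in L, ‖φ j x‖ ^ 2 ∂μ ≤ 1 := by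
    intro j
    rw [← h.orthonormal.integral_norm_sq_eq_one j]
    exact setIntegral_le_integral (integrable_norm_sq (φ j))
      (Eventually.of_forall fun y => sq_nonneg _)
  have h0 : ∀ j, 0 ≤ ∫ x in L, ‖φ j x‖ ^ 2 ∂μ := fun j => integral_nonneg fun x => sq_nonneg _
  have hsumm : Summable fun j => η j * ∫ x in L, ‖φ j x‖ ^ 2 ∂μ :=
    Summable.of_nonneg_of_le (fun j => mul_nonneg (hη j) (h0 j))
      (fun j => mul_le_of_le_one_right (hη j) (hle j)) hs
  rw [← ENNReal.ofReal_tsum_of_nonneg (fun j => mul_nonneg (hη j) (h0 j)) hsumm,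
    ENNReal.ofReal_eq_ofReal_iff hre0 (tsum_nonneg fun j => mul_nonneg (hη j) (h0 j))] at htrace
  have hswap : ∑' j, η j * ∫ x in L, ‖φ j x‖ ^ 2 ∂μ =
      ∫ x in L, ∑' j, η j * ‖φ j x‖ ^ 2 ∂μ := by
    have := hasSum_integral_of_summable_integral_norm hI (by
      simp_rw [Real.norm_of_nonneg (mul_nonneg (hη _) (sq_nonneg _)), integral_const_mul]
      exact hsumm)
    simp_rw [integral_const_mul] at this
    exact this.tsum_eq
  refine Complex.ext ?_ ?_
  · rw [htrace, hswap, Complex.ofReal_re]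
  · rw [him, Complex.ofReal_im]

/-- Equality of integrals over all compact subsets of `D` forces equality almost everywhere on each
compact piece, whose closed subsets are again compact. Countably many such pieces exhaust `D` up to
a null set. -/
theorem IsAdmissible.ae_restrict_diag [T2Space Λ] [SigmaFinite μ] [μ.InnerRegularCompactLTTop]
    (hS : IsAdmissible μ K S) (hT : IsIntegralOperator μ (restrictKernel K D) T)
    (hD : MeasurableSet D) (h : IsSpectralExpansion T φ η) (hs : Summable η) :
    ∀ᵐ x ∂(μ.restrict D),
      HasSum (fun j => (η j : ℂ) * (φ j x * conj (φ j x))) (K x x) := by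
  have hη := fun j => (h.pos j).le
  obtain ⟨hgood, hgint⟩ := h.orthonormal.ae_summable_and_integrable hη hs
  obtain ⟨L, hL, hnull⟩ := hD.exists_iUnion_isCompact_ae_eq (μ := μ)
  have hLae : ∀ i, ∀ᵐ x ∂(μ.restrict (L i)), K x x = ((∑' j, η j * ‖φ j x‖ ^ 2 : ℝ) : ℂ) := by
    intro i
    have hcint : Integrable (fun x => ((∑' j, η j * ‖φ j x‖ ^ 2 : ℝ) : ℂ)) μ := hgint.ofReal
    have h1 := ae_eq_zero_of_forall_setIntegral_isClosed_eq_zero (μ := μ.restrict (L i))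
      (f := fun x => K x x - ((∑' j, η j * ‖φ j x‖ ^ 2 : ℝ) : ℂ))
      ((hS.setIntegral_diag hT hD h hs (hL i).2 (hL i).1).1.sub hcint.integrableOn) ?_
    · filter_upwards [h1] with x hx using sub_eq_zero.1 hx
    · intro s hsc
      rw [Measure.restrict_restrict hsc.measurableSet]
      obtain ⟨h2, h3⟩ := hS.setIntegral_diag hT hD h hs ((hL i).2.inter_left hsc)
        (Set.inter_subset_right.trans (hL i).1)
      rw [integral_sub h2 hcint.integrableOn, h3, integral_complex_ofReal, sub_self]
  have hU := (ae_restrict_iUnion_iff L _).2 hLae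
  have hDle : ∀ᵐ x ∂(μ.restrict D), K x x = ((∑' j, η j * ‖φ j x‖ ^ 2 : ℝ) : ℂ) := by
    have hUm : MeasurableSet (⋃ i, L i) := MeasurableSet.iUnion fun i => (hL i).2.measurableSet
    rw [ae_restrict_iff' hUm] at hU
    rw [ae_restrict_iff' hD]
    have hnull' : ∀ᵐ x ∂μ, x ∉ D \ ⋃ i, L i := measure_eq_zero_iff_ae_notMem.1 hnull
    filter_upwards [hU, hnull'] with x h1 h2 hxD
    exact h1 (by by_contra hx; exact h2 ⟨hxD, hx⟩)
  filter_upwards [hDle, ae_restrict_of_ae hgood] with x h1 h2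
  rw [h1]
  have h3 : HasSum (fun j => ((η j * ‖φ j x‖ ^ 2 : ℝ) : ℂ))
      ((∑' j, η j * ‖φ j x‖ ^ 2 : ℝ) : ℂ) := Complex.hasSum_ofReal.2 h2.hasSum
  refine h3.congr_fun fun j => ?_
  rw [Complex.mul_conj, Complex.normSq_eq_norm_sq]
  push_cast
  rfl

/-- The kernel of a good operator, restricted to a set on which it is trace class, has an expansion
in eigenfunctions. -/
theorem IsAdmissible.hasKernelExpansion [T2Space Λ] [SigmaFinite μ] [μ.InnerRegularCompactLTTop]
    [MeasurableSpace.CountablyGenerated Λ] (hS : IsAdmissible μ K S)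
    (hT : IsIntegralOperator μ (restrictKernel K D) T) (hD : MeasurableSet D)
    (h : IsSpectralExpansion T φ η) (hs : Summable η) :
    HasKernelExpansion (μ.restrict D) K (fun j => (φ j : Λ → ℂ)) η := by
  -- The range of `T` consists of functions vanishing off `D`, so eigenfunctions with nonzero
  -- eigenvalue do too and stay orthonormal in `L²` of `μ.restrict D`.
  have hφD : ∀ j, φ j = indicatorLp hD (φ j) := by
    intro j
    have hne : (η j : ℂ) ≠ 0 := by exact_mod_cast (h.pos j).ne'
    have h1 : indicatorLp hD (T (φ j)) = T (φ j) := by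
      rw [hS.isIntegralOperator.apply_eq_indicatorLp hT hD,
        indicatorLp_indicatorLp_of_subset hD hD subset_rfl]
    have h2 : indicatorLp hD ((η j : ℂ) • φ j) = (η j : ℂ) • indicatorLp hD (φ j) := by
      refine Lp.ext ?_
      filter_upwards [coeFn_indicatorLp hD ((η j : ℂ) • φ j), Lp.coeFn_smul (η j : ℂ) (φ j),
        Lp.coeFn_smul (η j : ℂ) (indicatorLp hD (φ j)), coeFn_indicatorLp hD (φ j)]
        with x e1 e2 e3 e4
      rw [e1, e3, Pi.smul_apply, e4]
      by_cases hx : x ∈ D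
      · rw [Set.indicator_of_mem hx, Set.indicator_of_mem hx, e2, Pi.smul_apply]
      · rw [Set.indicator_of_notMem hx, Set.indicator_of_notMem hx, smul_zero]
    rw [h.apply_eq, h2] at h1
    exact (smul_right_injective _ hne h1).symm
  have hinner : ∀ i j, ∫ x in D, φ i x * conj (φ j x) ∂μ = ⟪φ j, φ i⟫_ℂ := by
    intro i j
    rw [L2.inner_def, ← integral_indicator hD]
    refine integral_congr_ae ?_
    have e1 := coeFn_indicatorLp hD (φ i)
    rw [← hφD i] at e1
    filter_upwards [e1] with x hx
    by_cases hxD : x ∈ D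
    · simp [hxD, RCLike.inner_apply]
    · rw [Set.indicator_of_notMem hxD] at hx
      simp [hxD, hx]
  refine ⟨fun j => (Lp.memLp (φ j)).restrict D, fun j => ?_, fun i j hij => ?_,
    fun j => (h.pos j).le, hs, hS.ae_restrict_diag hT hD h hs, ?_⟩
  · rw [hinner, inner_self_eq_norm_sq_to_K, h.orthonormal.1]; simp
  · rw [hinner, h.orthonormal.2 hij.symm]
  · rw [Measure.prod_restrict, ae_restrict_iff' (hD.prod hD)]
    filter_upwards [h.ae_prod_hasSum hs (measurable_restrictKernel hS.measurable hD) hT]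
      with p hp hpD
    simpa [restrictKernel, hpD.1, hpD.2] using hp

end Diagonal

/-! ### The law of the count and the moderate deviation principle -/

section Main

/-- The data of the eigenvalues of a trace class restriction of a good kernel, together with the
law of the number of points. -/
theorem exists_hasBernoulliMGF_countIn {Λ Ω : Type*} [TopologicalSpace Λ] [PolishSpace Λ]
    [LocallyCompactSpace Λ] [MeasurableSpace Λ] [BorelSpace Λ] {μ : Measure Λ}
    [IsLocallyFiniteMeasure μ] [MeasurableSpace Ω] {P : Measure Ω} [IsProbabilityMeasure P]
    {χ : Ω → Measure Λ} {K : Λ → Λ → ℂ} (hK : IsGoodKernel μ K) (hχ : IsDeterminantal P χ μ K)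
    {D : Set Λ} (hD : MeasurableSet D) {T : Lp ℂ 2 μ →L[ℂ] Lp ℂ 2 μ}
    (hT : IsIntegralOperator μ (restrictKernel K D) T) (hTtr : IsTraceClass T) :
    ∃ (ι : Type) (η : ι → ℝ), HasBernoulliMGF (countIn χ D) P η ∧
      (∀ᵐ ω ∂P, χ ω D ≠ ∞) ∧ MemLp (countIn χ D) 2 P ∧
      ∫ ω, countIn χ D ω ∂P = ∑' j, η j ∧
      variance (countIn χ D) P = ∑' j, η j * (1 - η j) ∧
      eigenvalueSum T = ∑' j, η j * (1 - η j) := by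
  obtain ⟨S, hS, hspec⟩ := hK
  have hT0 := hS.nonneg_restrict hT hD
  obtain ⟨ι, φ, η, hexp, heig⟩ := exists_isSpectralExpansion hT0 (hTtr.isCompactOperator hT0)
  have hs := hexp.summable hT0 hTtr
  -- A summable family of strictly positive numbers has a countable index set.
  have hcount : Countable ι := by
    rw [← Set.countable_univ_iff]
    refine hs.countable_support.mono fun j _ => (hexp.pos j).ne'
  have hη : ∀ j, η j ≤ 1 := fun j =>
    hS.eigenvalue_le_one hT hD hspec (hexp.orthonormal.1 j) (hexp.apply_eq j)
  have hker := hS.hasKernelExpansion hT hD hexp hs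
  obtain ⟨h1, h2, h3, h4⟩ := hχ.hasBernoulliMGF_countIn hD hker hη
  exact ⟨ι, η, h1, (hχ.ae_lt_top hD hker).mono fun ω hω => hω.ne, h2, h3, h4,
    heig h1.summable_variance⟩

end Main

end

theorem mainTheorem5 {Λ : Type*} [TopologicalSpace Λ] [PolishSpace Λ] [LocallyCompactSpace Λ]
    [MeasurableSpace Λ] [BorelSpace Λ] (μ : Measure Λ) [IsLocallyFiniteMeasure μ]
    {Ω : ℕ → Type*} [∀ n, MeasurableSpace (Ω n)] (P : ∀ n, Measure (Ω n))
    [∀ n, IsProbabilityMeasure (P n)]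
    (χ : ∀ n, Ω n → Measure Λ) (K : ℕ → Λ → Λ → ℂ)
    (hK : ∀ n, IsGoodKernel μ (K n))
    (hχ : ∀ n, IsDeterminantal (P n) (χ n) μ (K n))
    (D : ℕ → Set Λ) (hD : ∀ n, MeasurableSet (D n))
    (T : ℕ → Lp ℂ 2 μ →L[ℂ] Lp ℂ 2 μ)
    (hT : ∀ n, IsIntegralOperator μ (restrictKernel (K n) (D n)) (T n))
    (hTtr : ∀ n, IsTraceClass (T n))
    (a : ℕ → ℝ)
    (ha₁ : (fun _ : ℕ => (1 : ℝ)) =o[atTop] a)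
    (ha₂ : a =o[atTop] fun n => Real.sqrt (eigenvalueSum (T n))) :
    (∀ n, ∀ᵐ ω ∂(P n), χ n ω (D n) ≠ ∞) ∧
    (∀ n, MemLp (countIn (χ n) (D n)) 2 (P n)) ∧
    (∀ᶠ n in atTop, 0 < variance (countIn (χ n) (D n)) (P n)) ∧
    SatisfiesLDP
      (fun n => (P n).map fun ω =>
        (1 / a n) * ((countIn (χ n) (D n) ω - ∫ ω', countIn (χ n) (D n) ω' ∂(P n)) /
          Real.sqrt (variance (countIn (χ n) (D n)) (P n))))
      (fun n => a n ^ 2) (fun x : ℝ => x ^ 2 / 2) := by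
  have habs : Tendsto (fun n => |a n|) atTop atTop :=
    (Asymptotics.isLittleO_const_left.1 ha₁).resolve_left one_ne_zero
  choose ι η hmgf hfin hL2 hmean hvar heig using fun n =>
    exists_hasBernoulliMGF_countIn (hK n) (hχ n) (hD n) (hT n) (hTtr n)
  -- The variance is the eigenvalue sum, so the growth condition on `a` compares it with the
  -- standard deviation of the count.
  have hV : ∀ n, variance (countIn (χ n) (D n)) (P n) = eigenvalueSum (T n) := fun n =>
    (hvar n).trans (heig n).symm
  have hmeas : ∀ n, Measurable (countIn (χ n) (D n)) := fun n =>
    ((hχ n).measurable_apply (hD n)).ennreal_toReal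
  refine ⟨hfin, hL2, ?_, HasBernoulliMGF.moderate_deviations hmeas hmgf hmean hvar ha₁ ?_⟩
  · filter_upwards [ha₂.bound one_pos, habs.eventually_gt_atTop 0] with n h1 h2
    rw [one_mul, Real.norm_eq_abs, Real.norm_of_nonneg (Real.sqrt_nonneg _)] at h1
    rw [hV n]
    exact Real.sqrt_pos.1 (h2.trans_le h1)
  · simpa only [hV] using ha₂
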